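/- For integers $n\ge 0$ let $p_{-6}(n)$ denote the number of $6$-colored partitions of $n$, i.e. partitions of $n$ into positive parts in which each part carries one of $6$ colors (the order of the parts being irrelevant); equivalently, $\sum_{n\ge 0}p_{-6}(n)q^n=\prod_{m\ge 1}(1-q^m)^{-6}$. Then for all integers $n\ge 0$ and $\alpha\ge 1$, $$p_{-6}\left(5^{\alpha}n+\frac{3\cdot 5^{\alpha}+1}{4}\right)\equiv 0\pmod{5^{\alpha}},$$ $$p_{-6}\left(5^{\alpha+1}n+\frac{11\cdot 5^{\alpha}+1}{4}\right)\equiv 0\pmod{5^{\alpha+1}},$$ $$p_{-6}\left(5^{\alpha+1}n+\frac{19\cdot 5^{\alpha}+1}{4}\right)\equiv 0\pmod{5^{\alpha+1}}.$$ -/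

import Mathlib

/-- A `k`-colored partition of `n`: a finite multiset of positive parts with sum `n`, where each
part carries one of `k` colors. The pair `(m, c)` is a part of size `m` with color `c`; the order
of the parts does not matter, and equal parts of different colors are distinguished. -/
@[ext]
structure ColoredPartition (k n : ℕ) where
  /-- the colored parts, with multiplicity -/
  parts : Multiset (ℕ × Fin k)
  /-- every part is a positive integer -/
  parts_pos : ∀ p ∈ parts, 0 < p.1
  /-- the parts sum to `n` -/
  parts_sum : (parts.map Prod.fst).sum = n

/-- There are finitely many `k`-colored partitions of `n`, so that counting them by `Nat.card`
gives their actual number. -/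
instance ColoredPartition.instFinite (k n : ℕ) : Finite (ColoredPartition k n) := by
  classical
  let B : Multiset (ℕ × Fin k) := n • (Finset.range (n + 1) ×ˢ (Finset.univ : Finset (Fin k))).val
  refine Finite.of_injective (β := Set.Iic B) (fun x => ⟨x.parts, ?_⟩) ?_
  · have hcard : Multiset.card x.parts ≤ n := by
      have h := Multiset.card_nsmul_le_sum (s := x.parts.map Prod.fst) (a := 1) (by
        intro m hm
        obtain ⟨p, hp, rfl⟩ := Multiset.mem_map.1 hm
        exact x.parts_pos p hp)
      simpa [x.parts_sum] using h
    refine Multiset.le_iff_count.2 fun a => ?_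
    by_cases ha : a ∈ x.parts
    · have hle : a.1 ≤ n := by
        have h := Multiset.single_le_sum (s := x.parts.map Prod.fst) (fun _ _ => Nat.zero_le _)
          a.1 (Multiset.mem_map_of_mem _ ha)
        simpa [x.parts_sum] using h
      have h1 : Multiset.count a
          (Finset.range (n + 1) ×ˢ (Finset.univ : Finset (Fin k))).val = 1 :=
        Multiset.count_eq_one_of_mem (Finset.nodup _) (by
          rw [Finset.mem_val, Finset.mem_product, Finset.mem_range]
          exact ⟨Nat.lt_succ_of_le hle, Finset.mem_univ _⟩)
      rw [Multiset.count_nsmul, h1, mul_one]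
      exact (Multiset.count_le_card a _).trans hcard
    · rw [Multiset.count_eq_zero_of_notMem ha]
      exact Nat.zero_le _
  · intro x y h
    exact ColoredPartition.ext (congrArg Subtype.val h)

/-- `coloredPartitionCount k n` is the number `p_{-k}(n)` of `k`-colored partitions of `n`. -/
noncomputable def coloredPartitionCount (k n : ℕ) : ℕ :=
  Nat.card (ColoredPartition k n)

/-- The quotient `(c * 5 ^ α + 1) / 4` is exact whenever `c` is congruent to `3` modulo `4`
(so for `c = 3, 11, 19`). -/
theorem four_dvd_mul_five_pow_add_one (c α : ℕ) (hc : c % 4 = 3) : 4 ∣ c * 5 ^ α + 1 := by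
  have h : 5 ^ α % 4 = 1 := by
    rw [Nat.pow_mod]
    norm_num
  rw [Nat.dvd_iff_mod_eq_zero, Nat.add_mod, Nat.mul_mod, hc, h]

/-! Write `q` for `X`, `E(q) = ∏ (1 - q ^ m)` and `U` for `section5 0`, which keeps the exponents
divisible by `5`. The generating function is `E⁻⁶`, and the numbers in the first congruence are the
coefficients of a series `P_α` obtained from it by repeatedly extracting residue classes modulo `5`.

Put `ζ = q E(q²⁵) / E(q)` and `τ = q E(q⁵)⁶ / E(q)⁶`. The `5`-dissection of `E` and its norm over
the fifth roots of unity give the modular equation `zeta_pow_five`, of degree five in `ζ` with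
coefficients in `ℤ[τ(q⁵)]`. Hence every `U(ζ ^ i)` is a polynomial in `τ` obeying a linear
recurrence, from which `fiveAdicBound_zetaPoly` reads off `5`-adic bounds. As `τ(q⁵) τ = ζ⁶`, the
maps `f ↦ U(f)` and `f ↦ U(ζ⁶ f)` preserve the multiples of `τ` in `ℤ[τ]`. Alternating them produces
`P_α` up to a unit and a power of `q`, and each application gains a factor `5`.

The bounds also show that only the lowest power of `τ` survives modulo `5 ^ (α + 1)`: for either
parity of `α`, `P_α ≡ c E(q⁵)⁶ / E¹²` with `5 ^ α ∣ c` (`exists_progressionSeries_eq`). Modulo `5`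
the quotient is `E(q⁵)³ E³`, and by Jacobi's identity `E³` has no exponents congruent to `2` or `4`
modulo `5`. This gives the two remaining congruences. -/

namespace SixColored

open PowerSeries Finset

/-! ### Truncated Euler products and extraction of residue classes modulo 5. -/

section General

variable {R : Type*} [CommRing R]

/-- Two power series that agree modulo every power of `X` are equal. -/
theorem eq_of_forall_X_pow_dvd_sub {f g : R⟦X⟧} (h : ∀ N, X ^ N ∣ f - g) : f = g := by
  ext n
  have h1 := X_pow_dvd_iff.1 (h (n + 1)) n n.lt_succ_self
  rwa [map_sub, sub_eq_zero] at h1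

theorem X_pow_dvd_rescale {N : ℕ} {f : R⟦X⟧} (a : R) (h : X ^ N ∣ f) : X ^ N ∣ rescale a f := by
  rw [X_pow_dvd_iff] at h ⊢
  intro m hm
  rw [coeff_rescale, h m hm, mul_zero]

theorem X_pow_dvd_expand {N p : ℕ} (hp : p ≠ 0) {f : R⟦X⟧} (h : X ^ N ∣ f) :
    X ^ N ∣ expand p hp f := by
  obtain ⟨g, rfl⟩ := h
  rw [map_mul, map_pow, expand_X, ← pow_mul]
  exact (pow_dvd_pow X (Nat.le_mul_of_pos_left N (Nat.pos_of_ne_zero hp))).mul_right _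

variable (R) in
/-- The partial product `∏_{m=1}^{N} (1 - q ^ m)`. -/
noncomputable def eulerProd (N : ℕ) : R⟦X⟧ := ∏ m ∈ range N, (1 - X ^ (m + 1))

@[simp] theorem eulerProd_zero : eulerProd R 0 = 1 := prod_range_zero _

theorem eulerProd_succ (N : ℕ) : eulerProd R (N + 1) = eulerProd R N * (1 - X ^ (N + 1)) :=
  prod_range_succ _ _

theorem X_pow_dvd_eulerProd_add_sub (N k : ℕ) :
    X ^ (N + 1) ∣ eulerProd R (N + k) - eulerProd R N := by
  induction k with
  | zero => simp
  | succ k ih =>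
    rw [← add_assoc, eulerProd_succ]
    have h : (X : R⟦X⟧) ^ (N + 1) ∣ X ^ (N + k + 1) := pow_dvd_pow X (by omega)
    have h2 := ih.sub (h.mul_left (eulerProd R (N + k)))
    convert h2 using 1
    ring

/-- The pentagonal number theorem in truncated form: it lets `pentagonalSeries` serve as the
infinite Euler product. -/
theorem X_pow_dvd_pentagonalSeries_sub (N : ℕ) :
    X ^ (N + 1) ∣ pentagonalSeries R - eulerProd R N := by
  rw [X_pow_dvd_iff]
  intro n hn
  obtain ⟨M, hM⟩ := Filter.eventually_atTop.1
    ((Filter.tendsto_finset_range).eventually (coeff_prod_one_sub_X_pow_eventually_eq R n))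
  have h1 := hM (N + M) (Nat.le_add_left _ _)
  have h2 := X_pow_dvd_iff.1 (X_pow_dvd_eulerProd_add_sub (R := R) N M) n hn
  rw [map_sub, sub_eq_zero] at h2 ⊢
  rw [← h1, ← h2]
  rfl

theorem constantCoeff_eulerProd (N : ℕ) : constantCoeff (eulerProd R N) = 1 := by
  simp [eulerProd, map_prod]

theorem isUnit_eulerProd (N : ℕ) : IsUnit (eulerProd R N) :=
  isUnit_iff_constantCoeff.2 (by simp [constantCoeff_eulerProd])

theorem constantCoeff_pentagonalSeries : constantCoeff (pentagonalSeries R) = 1 := by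
  have h := X_pow_dvd_iff.1 (X_pow_dvd_pentagonalSeries_sub (R := R) 0) 0 (by omega)
  simpa [sub_eq_zero] using h

theorem isUnit_pentagonalSeries : IsUnit (pentagonalSeries R) :=
  isUnit_iff_constantCoeff.2 (by simp [constantCoeff_pentagonalSeries])

theorem map_pentagonalSeries {S : Type*} [CommRing S] (f : R →+* S) :
    map f (pentagonalSeries R) = pentagonalSeries S := by
  ext n
  rw [coeff_map]
  by_cases h : n ∈ Set.range pentagonal
  · obtain ⟨k, rfl⟩ := h
    simp
  · simp [coeff_pentagonalSeries_eq_zero, h]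

/-- The substitution `q ↦ q ^ 5`. -/
noncomputable abbrev expandFive : R⟦X⟧ →ₐ[R] R⟦X⟧ := expand 5 (by norm_num)

/-- The series `∑ f_{5 n + r} q ^ n`. -/
noncomputable def section5 (r : ℕ) : R⟦X⟧ →ₗ[R] R⟦X⟧ where
  toFun f := mk fun n => coeff (5 * n + r) f
  map_add' f g := by ext; simp
  map_smul' c f := by ext; simp

@[simp] theorem coeff_section5 (r n : ℕ) (f : R⟦X⟧) :
    coeff n (section5 r f) = coeff (5 * n + r) f := by
  simp [section5]

theorem section5_expandFive_mul {r : ℕ} (hr : r < 5) (g f : R⟦X⟧) :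
    section5 r (expandFive g * f) = g * section5 r f := by
  ext n
  rw [coeff_section5, coeff_mul, coeff_mul]
  symm
  refine sum_of_injOn (fun p => (5 * p.1, 5 * p.2 + r)) ?_ ?_ ?_ ?_
  · rintro ⟨a, b⟩ _ ⟨c, d⟩ _ h
    simp only [Prod.mk.injEq] at h ⊢
    omega
  · rintro ⟨a, b⟩ h
    simp only [mem_coe, HasAntidiagonal.mem_antidiagonal] at h ⊢
    omega
  · rintro ⟨a, b⟩ h h2
    rw [HasAntidiagonal.mem_antidiagonal] at h
    by_cases h5 : 5 ∣ a
    · obtain ⟨c, rfl⟩ := h5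
      refine absurd ⟨(c, n - c), ?_, ?_⟩ h2
      · simp only [mem_coe, HasAntidiagonal.mem_antidiagonal] at h ⊢
        omega
      · simp only [Prod.mk.injEq, true_and] at h ⊢
        omega
    · simp only [coeff_expand_of_not_dvd 5 _ g h5, zero_mul]
  · rintro ⟨a, b⟩ _
    simp [coeff_expand_mul]

theorem section5_X_pow_mul {a b r s : ℕ} (hs : s < 5) (h : b + s = 5 * a + r) (f : R⟦X⟧) :
    section5 r (X ^ b * f) = X ^ a * section5 s f := by
  ext n
  rw [coeff_section5, coeff_X_pow_mul', coeff_X_pow_mul', coeff_section5]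
  by_cases hn : a ≤ n
  · rw [if_pos (by omega), if_pos hn]
    congr 1
    congr 1
    omega
  · rw [if_neg (by omega), if_neg hn]

theorem section5_expandFive (g : R⟦X⟧) : section5 0 (expandFive g) = g := by
  ext n
  rw [coeff_section5, add_zero, coeff_expand_mul]

theorem section5_expandFive_of_ne {r : ℕ} (h0 : r ≠ 0) (hr : r < 5) (g : R⟦X⟧) :
    section5 r (expandFive g) = 0 := by
  ext n
  rw [coeff_section5, coeff_expand_of_not_dvd _ _ _ (by omega), map_zero]

theorem eq_sum_section5 (f : R⟦X⟧) :
    f = ∑ r ∈ range 5, X ^ r * expandFive (section5 r f) := by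
  ext n
  rw [map_sum, sum_eq_single (n % 5)]
  · rw [coeff_X_pow_mul', if_pos (Nat.mod_le _ _), show n - n % 5 = 5 * (n / 5) by omega,
      coeff_expand_mul, coeff_section5, Nat.div_add_mod]
  · intro r hr h
    rw [mem_range] at hr
    rw [coeff_X_pow_mul']
    split_ifs with h1
    · exact coeff_expand_of_not_dvd _ _ _ (by omega)
    · rfl
  · intro h
    exact absurd (mem_range.2 (Nat.mod_lt _ (by norm_num))) h

/-- The sections of a series given by its components modulo `5`. -/
theorem section5_components (g₀ g₁ g₂ g₃ g₄ : R⟦X⟧) {f : R⟦X⟧}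
    (h : f = expandFive g₀ + X ^ 1 * expandFive g₁ + X ^ 2 * expandFive g₂ +
      X ^ 3 * expandFive g₃ + X ^ 4 * expandFive g₄) :
    section5 0 f = g₀ ∧ section5 1 f = g₁ ∧ section5 2 f = g₂ ∧ section5 3 f = g₃ ∧
      section5 4 f = g₄ := by
  have key (r s : ℕ) (hr : r < 5) (hs : s < 5) (g : R⟦X⟧) :
      section5 r (X ^ s * expandFive g) = if r = s then g else 0 := by
    split_ifs with h
    · rw [section5_X_pow_mul (a := 0) (s := 0) (by norm_num) (by omega), pow_zero, one_mul,
        section5_expandFive]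
    · by_cases hrs : s ≤ r
      · rw [section5_X_pow_mul (a := 0) (s := r - s) (by omega) (by omega),
          section5_expandFive_of_ne (by omega) (by omega), mul_zero]
      · rw [section5_X_pow_mul (a := 1) (s := r + 5 - s) (by omega) (by omega),
          section5_expandFive_of_ne (by omega) (by omega), mul_zero]
  have key0 (r : ℕ) (hr : r < 5) (g : R⟦X⟧) :
      section5 r (expandFive g) = if r = 0 then g else 0 := by
    simpa using key r 0 hr (by norm_num) g
  rw [h]
  refine ⟨?_, ?_, ?_, ?_, ?_⟩ <;>
    simp only [map_add, key0, key, Nat.reduceLT] <;> simp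

end General

/-! ### Jacobi's identity for the cube of the Euler product. -/

section Jacobi

/-- The reciprocal of `∏_{m=1}^{N-1} (1 - q ^ m)`, with the convention that it vanishes for
`N = 0`. -/
noncomputable def invEulerProd : ℕ → ℤ⟦X⟧
  | 0 => 0
  | N + 1 => Ring.inverse (eulerProd ℤ N)

theorem eulerProd_mul_invEulerProd (N : ℕ) : eulerProd ℤ N * invEulerProd (N + 1) = 1 :=
  Ring.mul_inverse_cancel _ (isUnit_eulerProd N)

theorem invEulerProd_eq (N : ℕ) : invEulerProd N = (1 - X ^ N) * invEulerProd (N + 1) := by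
  cases N with
  | zero => simp [invEulerProd]
  | succ N =>
    refine (isUnit_eulerProd (R := ℤ) N).mul_left_cancel ?_
    rw [eulerProd_mul_invEulerProd, ← mul_assoc, ← eulerProd_succ, eulerProd_mul_invEulerProd]

theorem triangle_succ (k : ℕ) : (k + 1) * (k + 1 + 1) / 2 = k * (k + 1) / 2 + (k + 1) := by
  rw [show (k + 1) * (k + 1 + 1) = k * (k + 1) + 2 * (k + 1) by ring,
    Nat.add_mul_div_left _ _ (by norm_num)]

/-- The coefficient of `z ^ k` in `(1 - z⁻¹) ∏_{i=1}^{n} (1 - z q ^ i) (1 - z⁻¹ q ^ i)`. -/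
noncomputable def thetaCoeff (n k : ℕ) : ℤ⟦X⟧ :=
  (-1) ^ k * X ^ (k * (k + 1) / 2) * eulerProd ℤ (2 * n + 1) * invEulerProd (n + 1 - k) *
    invEulerProd (n + k + 2)

theorem thetaCoeff_eq_zero {n k : ℕ} (h : n < k) : thetaCoeff n k = 0 := by
  rw [thetaCoeff, Nat.sub_eq_zero_of_le h]
  simp [invEulerProd]

theorem eulerProd_two_mul_succ (n : ℕ) : eulerProd ℤ (2 * (n + 1) + 1) =
    eulerProd ℤ (2 * n + 1) * (1 - X ^ (2 * n + 2)) * (1 - X ^ (2 * n + 3)) := by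
  rw [show 2 * (n + 1) + 1 = 2 * n + 1 + 1 + 1 by ring, eulerProd_succ, eulerProd_succ]

/-- Raising `n` multiplies the Laurent polynomial by `1 + q ^ (2n+2) - q ^ (n+1) (z + z⁻¹)`. Its
coefficients at `z ^ (-k-1)` and `z ^ k` are opposite, so the neighbour at `z⁻¹` enters as
`-thetaCoeff n 0`. -/
theorem thetaCoeff_succ_zero (n : ℕ) : thetaCoeff (n + 1) 0 =
    (1 + X ^ (2 * n + 2)) * thetaCoeff n 0 - X ^ (n + 1) * (thetaCoeff n 1 - thetaCoeff n 0) := by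
  simp only [thetaCoeff, eulerProd_two_mul_succ]
  have h1 : invEulerProd n = (1 - X ^ n) * ((1 - X ^ (n + 1)) * invEulerProd (n + 2)) := by
    rw [← invEulerProd_eq, ← invEulerProd_eq]
  have h2 := invEulerProd_eq (n + 1)
  have h3 := invEulerProd_eq (n + 2)
  simp only [Nat.add_sub_cancel, Nat.sub_zero, add_zero,
    show n + 1 + 1 = n + 2 from rfl, show n + 1 + 2 = n + 3 from rfl] at *
  rw [h1, h2, h3]
  norm_num
  ring

theorem thetaCoeff_succ_succ (n j : ℕ) : thetaCoeff (n + 1) (j + 1) =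
    (1 + X ^ (2 * n + 2)) * thetaCoeff n (j + 1) -
      X ^ (n + 1) * (thetaCoeff n j + thetaCoeff n (j + 2)) := by
  by_cases hj : n < j
  · simp [thetaCoeff_eq_zero, hj, show n < j + 1 by omega, show n < j + 2 by omega]
  obtain ⟨d, rfl⟩ := Nat.exists_eq_add_of_le (not_lt.1 hj)
  simp only [thetaCoeff, eulerProd_two_mul_succ, triangle_succ]
  have h3 := invEulerProd_eq (j + d + j + 3)
  have h2 := invEulerProd_eq (j + d + j + 2)
  have h1 := invEulerProd_eq d
  rw [show j + d + 1 + 1 - (j + 1) = d + 1 by omega, show j + d + 1 - (j + 1) = d by omega,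
    show j + d + 1 - j = d + 1 by omega, show j + d + 1 - (j + 2) = d - 1 by omega,
    show j + d + 1 + (j + 1) + 2 = j + d + j + 3 + 1 by omega,
    show j + d + (j + 1) + 2 = j + d + j + 3 by omega,
    show j + d + (j + 2) + 2 = j + d + j + 3 + 1 by omega, h2, h3, h1]
  cases d with
  | zero =>
    have h0 : invEulerProd (0 - 1) = 0 := rfl
    rw [h0]
    ring
  | succ e =>
    rw [show e + 1 - 1 = e by omega, invEulerProd_eq e, invEulerProd_eq (e + 1)]
    ring

/-- Since `(2k - 1) + (2k + 3) = 2 (2k + 1)`, adding the two neighbours doubles the weighted sum up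
to boundary terms. The weighted sum is the `z`-derivative at `z = 1`, so raising `n` multiplies it
by `1 + q ^ (2n+2) - 2 q ^ (n+1) = (1 - q ^ (n+1))²`. -/
theorem sum_odd_mul_shift {R : Type*} [CommRing R] (f g : ℕ → R) (h0 : g 0 = f 1 - f 0)
    (h : ∀ k, g (k + 1) = f k + f (k + 2)) (M : ℕ) :
    ∑ k ∈ range (M + 1), (2 * k + 1 : R) * g k =
      2 * ∑ k ∈ range (M + 1), (2 * k + 1 : R) * f k + (2 * M + 1) * f (M + 1) -
        (2 * M + 3) * f M := by
  induction M with
  | zero => simp [h0]; ring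
  | succ M ih =>
    rw [sum_range_succ, ih, sum_range_succ _ (M + 1), h]
    push_cast
    ring

/-- The finite form of Jacobi's identity. -/
theorem sum_thetaCoeff (n : ℕ) :
    ∑ k ∈ range (n + 1), (2 * k + 1 : ℤ⟦X⟧) * thetaCoeff n k = eulerProd ℤ n ^ 2 := by
  induction n with
  | zero =>
    have h := eulerProd_mul_invEulerProd 1
    simp [thetaCoeff, invEulerProd]
    simpa [invEulerProd] using h
  | succ n ih =>
    obtain ⟨g, hg0, hg⟩ : ∃ g : ℕ → ℤ⟦X⟧, g 0 = thetaCoeff n 1 - thetaCoeff n 0 ∧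
        ∀ k, g (k + 1) = thetaCoeff n k + thetaCoeff n (k + 2) :=
      ⟨fun k => Nat.casesOn k (thetaCoeff n 1 - thetaCoeff n 0)
        fun j => thetaCoeff n j + thetaCoeff n (j + 2), rfl, fun _ => rfl⟩
    have h := sum_odd_mul_shift (thetaCoeff n) g hg0 hg (n + 1)
    rw [sum_range_succ (fun k : ℕ => (2 * k + 1 : ℤ⟦X⟧) * thetaCoeff n k), ih,
      thetaCoeff_eq_zero n.lt_succ_self,
      thetaCoeff_eq_zero (show n < n + 1 + 1 by omega)] at h
    have h2 (k : ℕ) : (2 * k + 1 : ℤ⟦X⟧) * thetaCoeff (n + 1) k =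
        (1 + X ^ (2 * n + 2)) * ((2 * k + 1 : ℤ⟦X⟧) * thetaCoeff n k) -
        X ^ (n + 1) * ((2 * k + 1 : ℤ⟦X⟧) * g k) := by
      cases k with
      | zero => rw [thetaCoeff_succ_zero, hg0]; ring
      | succ j => rw [thetaCoeff_succ_succ, hg]; ring
    rw [sum_congr rfl fun k _ => h2 k, sum_sub_distrib, ← mul_sum, ← mul_sum, h,
      sum_range_succ, ih, thetaCoeff_eq_zero n.lt_succ_self, eulerProd_succ]
    ring

theorem X_pow_dvd_thetaCoeff {n k : ℕ} (hk : k ≤ n) :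
    X ^ (n + 1) ∣ eulerProd ℤ n * thetaCoeff n k - (-1) ^ k * X ^ (k * (k + 1) / 2) := by
  obtain ⟨d, rfl⟩ := Nat.exists_eq_add_of_le hk
  have ha : X ^ (k + d + 1) ∣
      eulerProd ℤ (2 * (k + d) + 1) * invEulerProd (k + d + k + 2) - 1 := by
    have h1 := (X_pow_dvd_eulerProd_add_sub (R := ℤ) (k + d + k + 1) d).mul_right
      (invEulerProd (k + d + k + 2))
    rw [sub_mul, eulerProd_mul_invEulerProd,
      show k + d + k + 1 + d = 2 * (k + d) + 1 by ring] at h1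
    exact (pow_dvd_pow X (by omega)).trans h1
  have hb : X ^ (d + 1) ∣ eulerProd ℤ (k + d) * invEulerProd (d + 1) - 1 := by
    have h1 := (X_pow_dvd_eulerProd_add_sub (R := ℤ) d k).mul_right (invEulerProd (d + 1))
    rwa [sub_mul, eulerProd_mul_invEulerProd, add_comm d k] at h1
  -- `hb` is accurate only to order `d + 1`; the triangular power of `X` supplies the missing `k`.
  have hk2 : k ≤ k * (k + 1) / 2 := by
    rw [Nat.le_div_iff_mul_le (by norm_num)]
    rcases k with _ | k
    · simp
    · exact Nat.mul_le_mul_left _ (by omega)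
  have hc : X ^ (k + d + 1) ∣ X ^ (k * (k + 1) / 2) *
      (eulerProd ℤ (k + d) * invEulerProd (d + 1) - 1) := by
    rw [add_assoc, pow_add]
    exact mul_dvd_mul (pow_dvd_pow X hk2) hb
  rw [thetaCoeff, show k + d + 1 - k = d + 1 by omega]
  convert ((ha.mul_left (X ^ (k * (k + 1) / 2) *
    (eulerProd ℤ (k + d) * invEulerProd (d + 1)))).add hc).mul_left ((-1) ^ k) using 1
  ring

/-- **Jacobi's identity** for the cube of the Euler product, modulo a power of `q`. -/
theorem X_pow_dvd_pentagonalSeries_pow_three_sub (n : ℕ) :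
    X ^ (n + 1) ∣ pentagonalSeries ℤ ^ 3 -
      ∑ k ∈ range (n + 1), (2 * k + 1 : ℤ⟦X⟧) * ((-1) ^ k * X ^ (k * (k + 1) / 2)) := by
  have h1 : X ^ (n + 1) ∣ eulerProd ℤ n ^ 3 -
      ∑ k ∈ range (n + 1), (2 * k + 1 : ℤ⟦X⟧) * ((-1) ^ k * X ^ (k * (k + 1) / 2)) := by
    rw [pow_succ' (eulerProd ℤ n) 2, ← sum_thetaCoeff, mul_sum, ← sum_sub_distrib]
    refine dvd_sum fun k hk => ?_
    convert (X_pow_dvd_thetaCoeff (mem_range_succ_iff.1 hk)).mul_left (2 * k + 1 : ℤ⟦X⟧) using 1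
    ring
  have h2 := (X_pow_dvd_pentagonalSeries_sub (R := ℤ) n).trans
    (sub_dvd_pow_sub_pow (pentagonalSeries ℤ) (eulerProd ℤ n) 3)
  convert h2.add h1 using 1
  ring

/-- Triangular numbers are `0`, `1` or `3` modulo `5`. -/
theorem section5_pentagonalSeries_pow_three {r : ℕ} (hr : r = 2 ∨ r = 4) :
    section5 r (pentagonalSeries ℤ ^ 3) = 0 := by
  ext n
  rw [coeff_section5, map_zero]
  have h := X_pow_dvd_iff.1 (X_pow_dvd_pentagonalSeries_pow_three_sub (5 * n + r)) (5 * n + r)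
    (by omega)
  rw [map_sub, sub_eq_zero] at h
  rw [h, map_sum]
  refine sum_eq_zero fun k _ => ?_
  rw [show (2 * k + 1 : ℤ⟦X⟧) * ((-1) ^ k * X ^ (k * (k + 1) / 2)) =
    C ((2 * k + 1) * (-1) ^ k : ℤ) * X ^ (k * (k + 1) / 2) by simp; ring,
    coeff_C_mul_X_pow, if_neg]
  intro h
  have h2 : k * (k + 1) = 2 * (5 * n + r) := by
    rw [h, Nat.mul_div_cancel' (Nat.even_mul_succ_self k).two_dvd]
  have h3 : k * (k + 1) % 5 = 2 * (5 * n + r) % 5 := by rw [h2]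
  have h4 : k % 5 = 0 ∨ k % 5 = 1 ∨ k % 5 = 2 ∨ k % 5 = 3 ∨ k % 5 = 4 := by omega
  rw [Nat.mul_mod, Nat.add_mod] at h3
  rcases hr with rfl | rfl <;> rcases h4 with h4 | h4 | h4 | h4 | h4 <;> rw [h4] at h3 <;>
    norm_num at h3 <;> omega

end Jacobi

/-! ### The 5-dissection of the Euler product. -/

section Dissection

theorem pentagonal_emod_five (k : ℤ) :
    (pentagonal k % 5 = 0 ∧ (k % 5 = 0 ∨ k % 5 = 2)) ∨ (pentagonal k % 5 = 1 ∧ k % 5 = 1) ∨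
      (pentagonal k % 5 = 2 ∧ (k % 5 = 3 ∨ k % 5 = 4)) := by
  have h : 2 * (pentagonal k : ℤ) % 5 = k * (3 * k - 1) % 5 := by
    rw [two_mul_natCast_pentagonal]
  have h4 : k % 5 = 0 ∨ k % 5 = 1 ∨ k % 5 = 2 ∨ k % 5 = 3 ∨ k % 5 = 4 := by omega
  rw [Int.mul_emod k, Int.sub_emod, Int.mul_emod 3] at h
  rcases h4 with h4 | h4 | h4 | h4 | h4 <;> rw [h4] at h <;> norm_num at h <;> omega

theorem pentagonal_one_sub_five_mul (k : ℤ) :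
    pentagonal (1 - 5 * k) = 5 * (5 * pentagonal k) + 1 := by
  have h1 := two_mul_natCast_pentagonal k
  have h2 := two_mul_natCast_pentagonal (1 - 5 * k)
  have h3 : (2 * pentagonal (1 - 5 * k) : ℤ) = 2 * (5 * (5 * pentagonal k) + 1) := by
    linear_combination h2 - 25 * h1
  omega

theorem section5_pentagonalSeries_eq_zero {r : ℕ} (hr : r = 3 ∨ r = 4) :
    section5 r (pentagonalSeries ℤ) = 0 := by
  ext n
  rw [coeff_section5, map_zero]
  refine coeff_pentagonalSeries_eq_zero _ ?_
  rintro ⟨k, hk⟩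
  have h := pentagonal_emod_five k
  rw [hk] at h
  omega

/-- Pentagonal exponents congruent to `1` come only from indices `1 - 5 l`; there the exponent is
`25 * pentagonal l + 1` and the sign is opposite to that of `l`. -/
theorem section5_one_pentagonalSeries :
    section5 1 (pentagonalSeries ℤ) = -expandFive (pentagonalSeries ℤ) := by
  ext n
  rw [coeff_section5, map_neg]
  by_cases h : ∃ k, n = 5 * pentagonal k
  · obtain ⟨k, rfl⟩ := h
    rw [← pentagonal_one_sub_five_mul, coeff_expand_mul, coeff_pentagonalSeries_pentagonal,
      coeff_pentagonalSeries_pentagonal, Int.negOnePow_sub,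
      show Int.negOnePow (5 * k) = Int.negOnePow k by
        rw [Int.negOnePow_eq_iff]; exact ⟨2 * k, by ring⟩]
    simp
  · rw [coeff_pentagonalSeries_eq_zero, coeff_expand]
    · split_ifs with h5
      · rw [coeff_pentagonalSeries_eq_zero, neg_zero]
        rintro ⟨k, hk⟩
        exact h ⟨k, by omega⟩
      · rw [neg_zero]
    · rintro ⟨k, hk⟩
      have h5 := pentagonal_emod_five k
      obtain ⟨l, rfl⟩ : ∃ l, k = 1 - 5 * l := ⟨(1 - k) / 5, by omega⟩
      rw [pentagonal_one_sub_five_mul] at hk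
      exact h ⟨l, by omega⟩

/-- The `5`-dissection of the Euler product. -/
theorem exists_dissection : ∃ A B : ℤ⟦X⟧, A * B = 1 ∧
    pentagonalSeries ℤ = expandFive (expandFive (pentagonalSeries ℤ)) *
      (expandFive A - X - X ^ 2 * expandFive B) := by
  set E := pentagonalSeries ℤ with hE
  set F := expandFive E with hF
  set a := section5 0 E with ha
  set b := section5 2 E with hb
  have hdis : E = expandFive a - X * expandFive F + X ^ 2 * expandFive b := by
    have h := eq_sum_section5 E
    rw [sum_range_succ, sum_range_succ, sum_range_succ, sum_range_succ, sum_range_one,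
      section5_pentagonalSeries_eq_zero (Or.inl rfl),
      section5_pentagonalSeries_eq_zero (Or.inr rfl), section5_one_pentagonalSeries] at h
    rw [h, map_neg, map_zero]
    ring
  have hX : (X : ℤ⟦X⟧) ^ 5 = expandFive X := (expand_X 5 _).symm
  -- Cubing the three-term dissection, the class of `2` is `3 a (a b + F²)`. Jacobi's identity makes
  -- it vanish, which forces `a b = -F²`.
  have hcube := (section5_components (a ^ 3 - X * (3 * F * b ^ 2)) (-(3 * a ^ 2 * F) + X * b ^ 3)
    (3 * a ^ 2 * b + 3 * a * F ^ 2) (-F ^ 3 - 6 * a * F * b) (3 * a * b ^ 2 + 3 * F ^ 2 * b)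
    (f := E ^ 3) (by
      rw [hdis]
      simp only [map_add, map_sub, map_mul, map_pow, map_neg, ← hX, map_ofNat]
      ring)).2.2.1
  rw [section5_pentagonalSeries_pow_three (Or.inl rfl)] at hcube
  have ha0 : a ≠ 0 := by
    intro h0
    have h1 : coeff 0 a = 1 := by
      rw [ha, coeff_section5, coeff_zero_eq_constantCoeff_apply, constantCoeff_pentagonalSeries]
    rw [h0, map_zero] at h1
    exact zero_ne_one h1
  have hab : a * b + F ^ 2 = 0 := by
    have h3 : (3 : ℤ⟦X⟧) * a * (a * b + F ^ 2) = 0 := by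
      rw [hcube]
      ring
    have h30 : (3 : ℤ⟦X⟧) ≠ 0 := by
      rw [← map_ofNat C 3]
      exact fun h => three_ne_zero (C_injective (h.trans (map_zero C).symm))
    exact (mul_eq_zero.1 h3).resolve_left (mul_ne_zero h30 ha0)
  obtain ⟨G, hG⟩ := ((isUnit_pentagonalSeries (R := ℤ)).map expandFive).exists_right_inv
  rw [← hE, ← hF] at hG
  have hG' : expandFive F * expandFive G = 1 := by rw [← map_mul, hG, map_one]
  -- `A = a / F` and `B = -b / F`.
  refine ⟨a * G, -(b * G), by linear_combination (-G ^ 2) * hab + (F * G + 1) * hG, ?_⟩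
  rw [map_neg, map_mul, map_mul]
  conv_lhs => rw [hdis]
  linear_combination (-(expandFive a) - X ^ 2 * expandFive b) * hG'

end Dissection

/-! ### The norm of the dissection over the fifth roots of unity. -/

section Norm

variable {R : Type*} [CommRing R]

theorem prod_one_sub_root_mul {ω : R} (h : 1 + ω + ω ^ 2 + ω ^ 3 + ω ^ 4 = 0) (Y : R) :
    ∏ i ∈ range 5, (1 - ω ^ i * Y) = 1 - Y ^ 5 := by
  have h5 : ω ^ 5 = 1 := by linear_combination (ω - 1) * h
  have h1 : (1 - ω * Y) * (1 - ω ^ 4 * Y) = 1 - (ω + ω ^ 4) * Y + Y ^ 2 := by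
    linear_combination Y ^ 2 * h5
  have h2 : (1 - ω ^ 2 * Y) * (1 - ω ^ 3 * Y) = 1 - (ω ^ 2 + ω ^ 3) * Y + Y ^ 2 := by
    linear_combination Y ^ 2 * h5
  have h3 : (ω + ω ^ 4) * (ω ^ 2 + ω ^ 3) = -1 := by
    linear_combination h + (ω + ω ^ 2) * h5
  have h4 : (ω ^ 2 + ω ^ 3) = -1 - (ω + ω ^ 4) := by linear_combination h
  simp only [prod_range_succ, prod_range_zero]
  calc _ = (1 - Y) * ((1 - ω * Y) * (1 - ω ^ 4 * Y)) * ((1 - ω ^ 2 * Y) * (1 - ω ^ 3 * Y)) := by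
        ring
    _ = _ := by
        rw [h1, h2]
        linear_combination (1 - Y) * Y ^ 2 * h3 - (1 - Y) * Y * (1 + Y ^ 2) * h

theorem prod_sub_root_mul_sub {ω A B : R} (h : 1 + ω + ω ^ 2 + ω ^ 3 + ω ^ 4 = 0)
    (hAB : A * B = 1) (Y : R) :
    ∏ i ∈ range 5, (A - ω ^ i * Y - (ω ^ i * Y) ^ 2 * B) =
      A ^ 5 - 11 * Y ^ 5 - Y ^ 10 * B ^ 5 := by
  have h5 : ω ^ 5 = 1 := by linear_combination (ω - 1) * h
  set s := ω + ω ^ 4 with hs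
  set s' := ω ^ 2 + ω ^ 3 with hs'
  have h3 : s * s' = -1 := by
    linear_combination h + (ω + ω ^ 2) * h5
  have h4 : s' = -1 - s := by linear_combination h
  -- Because `s + s' = s s' = -1` and `A B = 1`, the quadratic `A - y - y² B` splits as `A (1 + s y
  -- B) (1 + s' y B)`. The constant `-11` of the conclusion is `s⁵ + s'⁵`.
  have hfac (i : ℕ) : A - ω ^ i * Y - (ω ^ i * Y) ^ 2 * B =
      A * (1 - ω ^ i * (-(s * Y * B))) * (1 - ω ^ i * (-(s' * Y * B))) := by
    linear_combination (ω ^ i * Y + (ω ^ i * Y) ^ 2 * B) * hAB -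
      A * (ω ^ i * Y * B) ^ 2 * h3 - A * (ω ^ i * Y * B) * h4
  rw [prod_congr rfl fun i _ => hfac i, prod_mul_distrib, prod_mul_distrib, prod_const, card_range,
    prod_one_sub_root_mul h, prod_one_sub_root_mul h]
  have hss : s ^ 2 = 1 - s := by rw [h4] at h3; linear_combination -h3
  have hs5 : s ^ 5 = 5 * s - 3 := by
    linear_combination (s ^ 3 - s ^ 2 + 2 * s - 3) * hss
  have hs5' : s' ^ 5 = -8 - 5 * s := by
    rw [h4]
    linear_combination -hs5 - (5 * s ^ 2 + 5 * s + 10) * hss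
  have hAB5 : A ^ 5 * B ^ 5 = 1 := by rw [← mul_pow, hAB, one_pow]
  have hss5 : s ^ 5 * s' ^ 5 = -1 := by rw [← mul_pow, h3]; norm_num
  linear_combination A ^ 5 * Y ^ 5 * B ^ 5 * (hs5 + hs5') + A ^ 5 * Y ^ 10 * B ^ 10 * hss5 -
    (11 * Y ^ 5 + Y ^ 10 * B ^ 5) * hAB5

/-- The product of the five twists `f(ω ^ i q)`. -/
noncomputable def twistProd (ω : R) : R⟦X⟧ →* R⟦X⟧ where
  toFun f := ∏ i ∈ range 5, rescale (ω ^ i) f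
  map_one' := by simp
  map_mul' f g := by simp [prod_mul_distrib]

theorem twistProd_apply (ω : R) (f : R⟦X⟧) :
    twistProd ω f = ∏ i ∈ range 5, rescale (ω ^ i) f := rfl

theorem rescale_expandFive {ω : R} (h5 : ω ^ 5 = 1) (i : ℕ) (f : R⟦X⟧) :
    rescale (ω ^ i) (expandFive f) = expandFive f := by
  ext n
  rw [coeff_rescale, coeff_expand]
  split_ifs with h
  · obtain ⟨m, rfl⟩ := h
    rw [← pow_mul, show i * (5 * m) = 5 * (i * m) by ring, pow_mul, h5, one_pow, one_mul]
  · rw [mul_zero]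

theorem rescale_X_pow (a : R) (m : ℕ) : rescale a (X ^ m) = C a ^ m * X ^ m := by
  rw [map_pow, rescale_X, mul_pow]

theorem twistProd_one_sub_X_pow {ω : R} (h : 1 + ω + ω ^ 2 + ω ^ 3 + ω ^ 4 = 0) (m : ℕ) :
    twistProd ω (1 - X ^ m) = if 5 ∣ m then (1 - X ^ m) ^ 5 else 1 - X ^ (5 * m) := by
  have h5 : ω ^ 5 = 1 := by linear_combination (ω - 1) * h
  have hfac (i : ℕ) : rescale (ω ^ i) (1 - X ^ m) = 1 - (C ω ^ m) ^ i * X ^ m := by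
    rw [map_sub, map_one, rescale_X_pow, map_pow, ← pow_mul, ← pow_mul, mul_comm i m]
  rw [twistProd_apply, prod_congr rfl fun i _ => hfac i, ← map_pow]
  split_ifs with hm
  · obtain ⟨l, rfl⟩ := hm
    rw [pow_mul, h5, one_pow]
    simp
  · rw [prod_one_sub_root_mul, ← pow_mul, mul_comm m 5]
    rw [← Nat.div_add_mod m 5, pow_add, pow_mul, h5, one_pow, one_mul]
    have h4 : m % 5 = 1 ∨ m % 5 = 2 ∨ m % 5 = 3 ∨ m % 5 = 4 := by omega
    have hC : 1 + C ω + C ω ^ 2 + C ω ^ 3 + C ω ^ 4 = 0 := by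
      simpa using congrArg C h
    have hC5 : C ω ^ 5 = 1 := by rw [← map_pow, h5, map_one]
    rcases h4 with h4 | h4 | h4 | h4 <;> rw [h4, map_pow]
    · linear_combination hC
    · linear_combination hC + (C ω + C ω ^ 3) * hC5
    · linear_combination hC + (C ω + C ω ^ 4 + C ω ^ 2 * (1 + C ω ^ 5)) * hC5
    · linear_combination hC + (C ω ^ 3 + C ω ^ 2 * (1 + C ω ^ 5) +
        C ω * (1 + C ω ^ 5 + C ω ^ 10)) * hC5

theorem expandFive_eulerProd_succ (N : ℕ) :
    expandFive (eulerProd R (N + 1)) = expandFive (eulerProd R N) * (1 - X ^ (5 * (N + 1))) := by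
  rw [eulerProd_succ, map_mul, map_sub, map_one, map_pow, expand_X, ← pow_mul]

/-- The factors with `5 ∤ m` give `1 - q ^ (5m)` and the others give fifth powers. The second factor
on the left restores the `1 - q ^ (25m)` needed to complete `E(q⁵)`. -/
theorem twistProd_eulerProd {ω : R} (h : 1 + ω + ω ^ 2 + ω ^ 3 + ω ^ 4 = 0) (N : ℕ) :
    twistProd ω (eulerProd R (5 * N)) * expandFive (expandFive (eulerProd R N)) =
      expandFive (eulerProd R (5 * N)) * expandFive (eulerProd R N) ^ 5 := by
  induction N with
  | zero => simp
  | succ N ih =>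
    rw [show 5 * (N + 1) = 5 * N + 1 + 1 + 1 + 1 + 1 by ring]
    simp only [expandFive_eulerProd_succ]
    simp only [eulerProd_succ, map_mul, twistProd_one_sub_X_pow h]
    rw [if_neg (by omega), if_neg (by omega), if_neg (by omega), if_neg (by omega),
      if_pos (by omega), map_sub, map_one, map_pow, expand_X]
    linear_combination (1 - X ^ (5 * (5 * N + 1))) * (1 - X ^ (5 * (5 * N + 1 + 1))) *
      (1 - X ^ (5 * (5 * N + 1 + 1 + 1))) * (1 - X ^ (5 * (5 * N + 1 + 1 + 1 + 1))) *
      (1 - X ^ (5 * N + 1 + 1 + 1 + 1 + 1)) ^ 5 *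
      (1 - (X ^ 5) ^ (5 * (N + 1))) * ih

theorem X_pow_dvd_twistProd_sub (ω : R) {N : ℕ} {f g : R⟦X⟧} (h : X ^ N ∣ f - g) :
    X ^ N ∣ twistProd ω f - twistProd ω g := by
  have hs (i : ℕ) := X_pow_dvd_rescale (ω ^ i) h
  simp only [map_sub, ← Ideal.mem_span_singleton, ← Ideal.Quotient.eq] at hs ⊢
  simp only [twistProd_apply, map_prod, hs]

theorem twistProd_pentagonalSeries {ω : R} (h : 1 + ω + ω ^ 2 + ω ^ 3 + ω ^ 4 = 0) :
    twistProd ω (pentagonalSeries R) * expandFive (expandFive (pentagonalSeries R)) =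
      expandFive (pentagonalSeries R) ^ 6 := by
  refine eq_of_forall_X_pow_dvd_sub fun N => ?_
  have h1 := (pow_dvd_pow X N.le_succ).trans (X_pow_dvd_pentagonalSeries_sub (R := R) N)
  have h2 := (pow_dvd_pow X (show N ≤ 5 * N + 1 by omega)).trans
    (X_pow_dvd_pentagonalSeries_sub (R := R) (5 * N))
  have h3 := X_pow_dvd_twistProd_sub ω h2
  have h4 := X_pow_dvd_expand (p := 5) (by norm_num) h1
  have h5 := X_pow_dvd_expand (p := 5) (by norm_num) h4
  have h6 := X_pow_dvd_expand (p := 5) (by norm_num) h2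
  simp only [map_sub, ← Ideal.mem_span_singleton, ← Ideal.Quotient.eq] at h3 h4 h5 h6 ⊢
  rw [map_mul, h3, h5, ← map_mul, twistProd_eulerProd h, map_mul, map_pow, map_pow, ← h6, ← h4]
  ring

theorem expandFive_injective : Function.Injective (expandFive : R⟦X⟧ → R⟦X⟧) := fun f g h => by
  rw [← section5_expandFive f, h, section5_expandFive]

theorem twistProd_dissection {ω : R} (h : 1 + ω + ω ^ 2 + ω ^ 3 + ω ^ 4 = 0) {A B : R⟦X⟧}
    (hAB : A * B = 1) : twistProd ω (expandFive A - X - X ^ 2 * expandFive B) =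
      expandFive (A ^ 5 - 11 * X - X ^ 2 * B ^ 5) := by
  have h5 : ω ^ 5 = 1 := by linear_combination (ω - 1) * h
  have hC : 1 + C ω + C ω ^ 2 + C ω ^ 3 + C ω ^ 4 = 0 := by
    simpa using congrArg C h
  have hfac (i : ℕ) : rescale (ω ^ i) (expandFive A - X - X ^ 2 * expandFive B) =
      expandFive A - C ω ^ i * X - (C ω ^ i * X) ^ 2 * expandFive B := by
    rw [map_sub, map_sub, map_mul, rescale_expandFive h5, rescale_expandFive h5, rescale_X_pow,
      rescale_X, map_pow, mul_pow]
  rw [twistProd_apply, prod_congr rfl fun i _ => hfac i,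
    prod_sub_root_mul_sub hC (by rw [← map_mul, hAB, map_one])]
  simp only [map_sub, map_mul, map_pow, map_ofNat, expand_X]
  ring

theorem pentagonalSeries_pow_six_of_root [IsDomain R] {ω : R}
    (h : 1 + ω + ω ^ 2 + ω ^ 3 + ω ^ 4 = 0) {A B : R⟦X⟧} (hAB : A * B = 1)
    (hE : pentagonalSeries R = expandFive (expandFive (pentagonalSeries R)) *
      (expandFive A - X - X ^ 2 * expandFive B)) :
    pentagonalSeries R ^ 6 =
      expandFive (pentagonalSeries R) ^ 6 * (A ^ 5 - 11 * X - X ^ 2 * B ^ 5) := by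
  have h5 : ω ^ 5 = 1 := by linear_combination (ω - 1) * h
  have h1 := twistProd_pentagonalSeries h
  have h2 : twistProd ω (expandFive (expandFive (pentagonalSeries R))) =
      expandFive (expandFive (pentagonalSeries R)) ^ 5 := by
    rw [twistProd_apply, prod_congr rfl fun i _ => rescale_expandFive h5 i _, prod_const,
      card_range]
  have h3 := congrArg (twistProd ω) hE
  rw [map_mul, h2, twistProd_dissection h hAB] at h3
  apply expandFive_injective
  rw [map_mul, map_pow, map_pow, ← h1, h3]
  ring

end Norm

theorem pentagonalSeries_pow_six {A B : ℤ⟦X⟧} (hAB : A * B = 1)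
    (hE : pentagonalSeries ℤ = expandFive (expandFive (pentagonalSeries ℤ)) *
      (expandFive A - X - X ^ 2 * expandFive B)) :
    pentagonalSeries ℤ ^ 6 =
      expandFive (pentagonalSeries ℤ) ^ 6 * (A ^ 5 - 11 * X - X ^ 2 * B ^ 5) := by
  -- The identity has integer coefficients, so it may be checked over `ℂ`, where a primitive fifth
  -- root of unity exists.
  let φ := Int.castRingHom ℂ
  apply map_injective φ (RingHom.injective_int φ)
  have hω := Complex.isPrimitiveRoot_exp 5 (by norm_num)
  have h0 := hω.geom_sum_eq_zero (by norm_num)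
  simp only [sum_range_succ, sum_range_zero, zero_add, pow_zero, pow_one] at h0
  have hAB' := congrArg (map φ) hAB
  have hE' := congrArg (map φ) hE
  simp only [map_mul, map_sub, map_pow, map_one, map_X, map_expand, map_pentagonalSeries,
    map_ofNat] at hAB' hE' ⊢
  exact pentagonalSeries_pow_six_of_root h0 hAB' hE'

/-! ### The modular equation and the sections of the first powers of `zeta`. -/

section ModularEquation

/-- The Euler product `∏ (1 - q ^ m)`. -/
noncomputable abbrev euler : ℤ⟦X⟧ := pentagonalSeries ℤ

/-- The reciprocal `∏ (1 - q ^ m)⁻¹` of the Euler product. -/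
noncomputable def eulerInv : ℤ⟦X⟧ := Ring.inverse euler

theorem euler_mul_eulerInv : euler * eulerInv = 1 :=
  Ring.mul_inverse_cancel _ isUnit_pentagonalSeries

theorem expandFive_euler_mul_eulerInv : expandFive euler * expandFive eulerInv = 1 := by
  rw [← map_mul, euler_mul_eulerInv, map_one]

/-- The series `q ∏ (1 - q ^ (25 m)) / (1 - q ^ m)`. -/
noncomputable def zeta : ℤ⟦X⟧ := X * expandFive (expandFive euler) * eulerInv

/-- The series `q ∏ (1 - q ^ (5 m)) ^ 6 / (1 - q ^ m) ^ 6`. -/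
noncomputable def tau : ℤ⟦X⟧ := X * expandFive euler ^ 6 * eulerInv ^ 6

theorem expandFive_tau_mul_tau : expandFive tau * tau = zeta ^ 6 := by
  have h : expandFive euler ^ 6 * expandFive eulerInv ^ 6 = 1 := by
    rw [← mul_pow, expandFive_euler_mul_eulerInv, one_pow]
  simp only [tau, zeta, map_mul, map_pow, expand_X]
  linear_combination X ^ 6 * expandFive (expandFive euler) ^ 6 * eulerInv ^ 6 * h

theorem tau_ne_zero : tau ≠ 0 := by
  intro h
  have h1 : tau * euler ^ 6 = X * expandFive euler ^ 6 := by
    have h2 : euler ^ 6 * eulerInv ^ 6 = 1 := by rw [← mul_pow, euler_mul_eulerInv, one_pow]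
    rw [tau]
    linear_combination X * expandFive euler ^ 6 * h2
  rw [h, zero_mul] at h1
  exact mul_ne_zero X_ne_zero
    (pow_ne_zero _ ((isUnit_pentagonalSeries (R := ℤ)).map expandFive).ne_zero) h1.symm

variable {A B : ℤ⟦X⟧}

theorem zeta_mul_dissection
    (hE : euler = expandFive (expandFive euler) * (expandFive A - X - X ^ 2 * expandFive B)) :
    zeta * (expandFive A - X - X ^ 2 * expandFive B) = X := by
  rw [zeta]
  linear_combination X * euler_mul_eulerInv - X * eulerInv * hE

theorem tau_mul_dissection (hAB : A * B = 1)
    (hE : euler = expandFive (expandFive euler) * (expandFive A - X - X ^ 2 * expandFive B)) :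
    tau * (A ^ 5 - 11 * X - X ^ 2 * B ^ 5) = X := by
  have h := pentagonalSeries_pow_six hAB hE
  have h2 : euler ^ 6 * eulerInv ^ 6 = 1 := by rw [← mul_pow, euler_mul_eulerInv, one_pow]
  rw [tau]
  linear_combination X * h2 - X * eulerInv ^ 6 * h

/-- `q ^ 5` in terms of `tau(q ^ 5)` and the dissection `e` of `q / zeta`. -/
theorem expandFive_tau_mul_eq {e : ℤ⟦X⟧} (hAB : A * B = 1)
    (hE : euler = expandFive (expandFive euler) * (expandFive A - X - X ^ 2 * expandFive B))
    (he : e = expandFive A - X - X ^ 2 * expandFive B) :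
    expandFive tau * (e ^ 5 + 5 * X * e ^ 4 + 15 * X ^ 2 * e ^ 3 + 25 * X ^ 3 * e ^ 2 +
      25 * X ^ 4 * e) = X ^ 5 := by
  have h := congrArg expandFive (tau_mul_dissection hAB hE)
  have hAB' : expandFive A * expandFive B = 1 := by rw [← map_mul, hAB, map_one]
  simp only [map_mul, map_sub, map_pow, map_ofNat, expand_X] at h
  have h2 : e ^ 5 + 5 * X * e ^ 4 + 15 * X ^ 2 * e ^ 3 + 25 * X ^ 3 * e ^ 2 + 25 * X ^ 4 * e =
      expandFive A ^ 5 - 11 * X ^ 5 - (X ^ 5) ^ 2 * expandFive B ^ 5 := by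
    set a := expandFive A
    set b := expandFive B
    -- With `u = e + X = a - X² b` and `a · X² b = X²`, one has `a⁵ - (X² b)⁵ = u⁵ + 5 X² u³ + 5 X⁴
    -- u`.
    have hu : e ^ 5 + 5 * X * e ^ 4 + 15 * X ^ 2 * e ^ 3 + 25 * X ^ 3 * e ^ 2 + 25 * X ^ 4 * e =
      (e + X) ^ 5 + 5 * X ^ 2 * (e + X) ^ 3 + 5 * X ^ 4 * (e + X) - 11 * X ^ 5 := by ring
    rw [hu, show e + X = a - X ^ 2 * b by rw [he]; ring]
    linear_combination (-5 * X ^ 2 * a ^ 3 + (10 * a * (a * b) - 5 * a) * X ^ 4 +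
      (-10 * b * (a * b) + 5 * b) * X ^ 6 + 5 * b ^ 3 * X ^ 8) * hAB'
  rw [h2, h]

/-- Substitute `e = X / zeta` in `expandFive_tau_mul_eq` and clear denominators. -/
theorem zeta_pow_five : zeta ^ 5 =
    expandFive tau * (1 + 5 * zeta + 15 * zeta ^ 2 + 25 * zeta ^ 3 + 25 * zeta ^ 4) := by
  obtain ⟨A, B, hAB, hE⟩ := exists_dissection
  have h1 := zeta_mul_dissection hE
  generalize he : expandFive A - X - X ^ 2 * expandFive B = e at h1
  have h2 := expandFive_tau_mul_eq hAB hE he.symm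
  refine X_pow_mul_cancel (k := 5) ?_
  calc X ^ 5 * zeta ^ 5 = expandFive tau * (e ^ 5 + 5 * X * e ^ 4 + 15 * X ^ 2 * e ^ 3 +
        25 * X ^ 3 * e ^ 2 + 25 * X ^ 4 * e) * zeta ^ 5 := by rw [h2]
    _ = _ := by
      rw [← h1]
      ring

theorem section5_zero_X_pow_five_mul (f : ℤ⟦X⟧) :
    section5 0 (X ^ 5 * f) = X * section5 0 f := by
  rw [section5_X_pow_mul (a := 1) (s := 0) (by norm_num) (by norm_num), pow_one]

/-- As `e = X / zeta`, these are the sections of `zeta⁻¹, …, zeta⁻⁴` multiplied by `X ^ 5`. They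
start the recurrence, since the modular equation times a negative power of `zeta` expresses `zeta,
…, zeta⁴` through them. -/
theorem section5_dissection_pow {e : ℤ⟦X⟧} (hAB : A * B = 1)
    (he : e = expandFive A - X - X ^ 2 * expandFive B) :
    section5 0 (X ^ 4 * e) = -X ∧ section5 0 (X ^ 3 * e ^ 2) = -X ∧
      section5 0 (X ^ 2 * e ^ 3) = 5 * X ∧ section5 0 (X * e ^ 4) = -(5 * X) := by
  have hAB' : expandFive A * expandFive B = 1 := by rw [← map_mul, hAB, map_one]
  have hX : (X : ℤ⟦X⟧) ^ 5 = expandFive X := (expand_X 5 _).symm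
  refine ⟨?_, ?_, ?_, ?_⟩
  · refine (section5_components (-X) (-(X * B)) 0 0 A ?_).1
    simp only [map_neg, map_mul, map_zero, ← hX]
    rw [he]
    ring
  · refine (section5_components (-X) (2 * X * B) (X * B ^ 2) (A ^ 2) (-(2 * A)) ?_).1
    simp only [map_neg, map_mul, map_pow, map_ofNat, ← hX]
    rw [he]
    linear_combination (-2 * X ^ 5) * hAB'
  · refine (section5_components (5 * X) 0 (A ^ 3 - 3 * X * B ^ 2) (-(3 * A ^ 2) - X * B ^ 3) 0
      ?_).1
    simp only [map_neg, map_sub, map_mul, map_pow, map_ofNat, map_zero, ← hX]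
    rw [he]
    linear_combination X ^ 2 * (-3 * X ^ 2 * expandFive A + 6 * X ^ 3 +
      3 * X ^ 4 * expandFive B) * hAB'
  · refine (section5_components (-(5 * X)) (A ^ 4 - 8 * X * B) (-(4 * A ^ 3) + 2 * X * B ^ 2)
      (2 * A ^ 2 + 4 * X * B ^ 3) (8 * A + X * B ^ 4) ?_).1
    simp only [map_neg, map_add, map_sub, map_mul, map_pow, map_ofNat, ← hX]
    rw [he]
    linear_combination X * (-4 * X ^ 2 * expandFive A ^ 2 + 12 * X ^ 3 * expandFive A +
      X ^ 4 * (6 * expandFive A * expandFive B - 6) - 12 * X ^ 5 * expandFive B -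
      4 * X ^ 6 * expandFive B ^ 2) * hAB'

theorem section5_zero_ofNat_mul (n : ℕ) [n.AtLeastTwo] (f : ℤ⟦X⟧) :
    section5 0 (ofNat(n) * f) = ofNat(n) * section5 0 f := by
  have h := section5_expandFive_mul (r := 0) (by norm_num) (OfNat.ofNat n) f
  rwa [map_ofNat] at h

theorem section5_zeta_pow_one_to_four :
    section5 0 zeta = 5 * tau ∧ section5 0 (zeta ^ 2) = 10 * tau + 125 * tau ^ 2 ∧
    section5 0 (zeta ^ 3) = 9 * tau + 375 * tau ^ 2 + 3125 * tau ^ 3 ∧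
    section5 0 (zeta ^ 4) = 4 * tau + 550 * tau ^ 2 + 12500 * tau ^ 3 + 78125 * tau ^ 4 := by
  obtain ⟨A, B, hAB, hE⟩ := exists_dissection
  have h1 := zeta_mul_dissection hE
  generalize he : expandFive A - X - X ^ 2 * expandFive B = e at h1
  have h2 := expandFive_tau_mul_eq hAB hE he.symm
  obtain ⟨s1, s2, s3, s4⟩ := section5_dissection_pow hAB he.symm
  have hX5 : section5 0 (X ^ 5 : ℤ⟦X⟧) = X := by
    rw [← expand_X 5 (by norm_num), section5_expandFive]
  have hz (i : ℕ) : X ^ 5 * zeta ^ i = expandFive tau * (e ^ 5 + 5 * X * e ^ 4 +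
      15 * X ^ 2 * e ^ 3 + 25 * X ^ 3 * e ^ 2 + 25 * X ^ 4 * e) * zeta ^ i := by
    rw [h2]
  have m1 : section5 0 zeta = 5 * tau := by
    have h : X ^ 5 * zeta = expandFive tau * (X * e ^ 4 + 5 * (X ^ 2 * e ^ 3) +
        15 * (X ^ 3 * e ^ 2) + 25 * (X ^ 4 * e) + 25 * X ^ 5) := by
      rw [← pow_one zeta, hz 1, ← h1]
      ring
    have h' := congrArg (section5 0) h
    rw [section5_zero_X_pow_five_mul, section5_expandFive_mul (by norm_num)] at h'
    simp only [map_add, section5_zero_ofNat_mul, s1, s2, s3, s4, hX5] at h'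
    refine X_mul_cancel (h'.trans ?_)
    ring
  have m2 : section5 0 (zeta ^ 2) = 10 * tau + 125 * tau ^ 2 := by
    have h : X ^ 5 * zeta ^ 2 = expandFive tau * (X ^ 2 * e ^ 3 + 5 * (X ^ 3 * e ^ 2) +
        15 * (X ^ 4 * e) + 25 * X ^ 5 + 25 * (X ^ 5 * zeta)) := by
      rw [hz, ← h1]
      ring
    have h' := congrArg (section5 0) h
    rw [section5_zero_X_pow_five_mul, section5_expandFive_mul (by norm_num)] at h'
    simp only [map_add, section5_zero_ofNat_mul, s1, s2, s3, hX5, section5_zero_X_pow_five_mul, m1] at h'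
    refine X_mul_cancel (h'.trans ?_)
    ring
  have m3 : section5 0 (zeta ^ 3) = 9 * tau + 375 * tau ^ 2 + 3125 * tau ^ 3 := by
    have h : X ^ 5 * zeta ^ 3 = expandFive tau * (X ^ 3 * e ^ 2 + 5 * (X ^ 4 * e) +
        15 * X ^ 5 + 25 * (X ^ 5 * zeta) + 25 * (X ^ 5 * zeta ^ 2)) := by
      rw [hz, ← h1]
      ring
    have h' := congrArg (section5 0) h
    rw [section5_zero_X_pow_five_mul, section5_expandFive_mul (by norm_num)] at h'
    simp only [map_add, section5_zero_ofNat_mul, s1, s2, hX5, section5_zero_X_pow_five_mul, m1, m2] at h'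
    refine X_mul_cancel (h'.trans ?_)
    ring
  refine ⟨m1, m2, m3, ?_⟩
  have h : X ^ 5 * zeta ^ 4 = expandFive tau * (X ^ 4 * e + 5 * X ^ 5 +
      15 * (X ^ 5 * zeta) + 25 * (X ^ 5 * zeta ^ 2) + 25 * (X ^ 5 * zeta ^ 3)) := by
    rw [hz, ← h1]
    ring
  have h' := congrArg (section5 0) h
  rw [section5_zero_X_pow_five_mul, section5_expandFive_mul (by norm_num)] at h'
  simp only [map_add, section5_zero_ofNat_mul, s1, hX5, section5_zero_X_pow_five_mul, m1, m2, m3] at h'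
  refine X_mul_cancel (h'.trans ?_)
  ring

end ModularEquation

/-! ### 5-adic bounds for the polynomials in `tau`. -/

section Valuation

/-- Evaluation of integer polynomials at `tau`. -/
noncomputable def evalTau : Polynomial ℤ →+* ℤ⟦X⟧ := Polynomial.eval₂RingHom C tau

@[simp] theorem evalTau_X : evalTau Polynomial.X = tau := Polynomial.eval₂_X _ _

theorem evalTau_C (c : ℤ) : evalTau (Polynomial.C c) = C c := Polynomial.eval₂_C _ _

/-- The polynomials expressing the sections of the powers of `zeta` in terms of `tau`. -/
noncomputable def zetaPoly : ℕ → Polynomial ℤ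
  | 0 => 1
  | 1 => 5 * Polynomial.X
  | 2 => 10 * Polynomial.X + 125 * Polynomial.X ^ 2
  | 3 => 9 * Polynomial.X + 375 * Polynomial.X ^ 2 + 3125 * Polynomial.X ^ 3
  | 4 => 4 * Polynomial.X + 550 * Polynomial.X ^ 2 + 12500 * Polynomial.X ^ 3 + 78125 * Polynomial.X ^ 4
  | i + 5 => Polynomial.X * (zetaPoly i + 5 * zetaPoly (i + 1) + 15 * zetaPoly (i + 2) +
      25 * zetaPoly (i + 3) + 25 * zetaPoly (i + 4))

theorem section5_zeta_pow (i : ℕ) :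
    section5 0 (zeta ^ i) = evalTau (zetaPoly i) := by
  have hrec (i : ℕ) : section5 0 (zeta ^ (i + 5)) = tau * (section5 0 (zeta ^ i) +
      5 * section5 0 (zeta ^ (i + 1)) + 15 * section5 0 (zeta ^ (i + 2)) +
      25 * section5 0 (zeta ^ (i + 3)) + 25 * section5 0 (zeta ^ (i + 4))) := by
    have h : zeta ^ (i + 5) = expandFive tau * (zeta ^ i + 5 * zeta ^ (i + 1) +
        15 * zeta ^ (i + 2) + 25 * zeta ^ (i + 3) + 25 * zeta ^ (i + 4)) := by
      linear_combination zeta ^ i * zeta_pow_five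
    rw [h, section5_expandFive_mul (by norm_num)]
    simp only [map_add, section5_zero_ofNat_mul]
  obtain ⟨m1, m2, m3, m4⟩ := section5_zeta_pow_one_to_four
  induction i using zetaPoly.induct with
  | case1 =>
    have h := section5_expandFive (1 : ℤ⟦X⟧)
    rw [map_one] at h
    rw [pow_zero, zetaPoly, map_one evalTau, h]
  | case2 => simp [zetaPoly, m1, map_ofNat]
  | case3 => simp [zetaPoly, m2, map_ofNat]
  | case4 => simp [zetaPoly, m3, map_ofNat]
  | case5 => simp [zetaPoly, m4, map_ofNat]
  | case6 i h0 h1 h2 h3 h4 =>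
    rw [hrec, h0, h1, h2, h3, h4, zetaPoly]
    simp only [map_mul, map_add, map_ofNat, evalTau_X]

/-- The `5`-adic bound satisfied by the coefficients of `zetaPoly i`. -/
def FiveAdicBound (i : ℕ) (p : Polynomial ℤ) : Prop :=
  ∀ j, (5 : ℤ) ^ ((5 * j - i - 1) / 2) ∣ p.coeff j ∧ (5 * j < i → p.coeff j = 0)

theorem FiveAdicBound.add {i : ℕ} {p q : Polynomial ℤ} (hp : FiveAdicBound i p)
    (hq : FiveAdicBound i q) : FiveAdicBound i (p + q) := fun j => by
  rw [Polynomial.coeff_add]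
  exact ⟨(hp j).1.add (hq j).1, fun h => by rw [(hp j).2 h, (hq j).2 h, add_zero]⟩

theorem fiveAdicBound_ofNat_mul_X_pow {i k c : ℕ} [c.AtLeastTwo] (hk : i ≤ 5 * k)
    (hc : 5 ^ ((5 * k - i - 1) / 2) ∣ c) :
    FiveAdicBound i (OfNat.ofNat c * Polynomial.X ^ k) := fun j => by
  rw [← map_ofNat Polynomial.C c, Polynomial.coeff_C_mul_X_pow]
  split_ifs with h
  · subst h
    exact ⟨by exact_mod_cast hc, fun h => absurd h (by omega)⟩
  · simp

theorem fiveAdicBound_zetaPoly (i : ℕ) : FiveAdicBound i (zetaPoly i) := by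
  induction i using zetaPoly.induct with
  | case1 =>
    intro j
    rw [zetaPoly, Polynomial.coeff_one]
    split_ifs with h
    · subst h
      simp
    · simp
  | case2 =>
    rw [zetaPoly, ← pow_one (Polynomial.X : Polynomial ℤ)]
    exact fiveAdicBound_ofNat_mul_X_pow (by norm_num) (by norm_num)
  | case3 =>
    rw [zetaPoly]
    nth_rewrite 1 [← pow_one (Polynomial.X : Polynomial ℤ)]
    exact (fiveAdicBound_ofNat_mul_X_pow (by norm_num) (by norm_num)).add
      (fiveAdicBound_ofNat_mul_X_pow (by norm_num) (by norm_num))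
  | case4 =>
    rw [zetaPoly]
    nth_rewrite 1 [← pow_one (Polynomial.X : Polynomial ℤ)]
    exact ((fiveAdicBound_ofNat_mul_X_pow (by norm_num) (by norm_num)).add
      (fiveAdicBound_ofNat_mul_X_pow (by norm_num) (by norm_num))).add
      (fiveAdicBound_ofNat_mul_X_pow (by norm_num) (by norm_num))
  | case5 =>
    rw [zetaPoly]
    nth_rewrite 1 [← pow_one (Polynomial.X : Polynomial ℤ)]
    exact (((fiveAdicBound_ofNat_mul_X_pow (by norm_num) (by norm_num)).add
      (fiveAdicBound_ofNat_mul_X_pow (by norm_num) (by norm_num))).add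
      (fiveAdicBound_ofNat_mul_X_pow (by norm_num) (by norm_num))).add
      (fiveAdicBound_ofNat_mul_X_pow (by norm_num) (by norm_num))
  | case6 i h0 h1 h2 h3 h4 =>
    intro j
    rw [zetaPoly]
    cases j with
    | zero => simp
    | succ j =>
      rw [Polynomial.coeff_X_mul]
      have hcoeff (n : ℕ) [n.AtLeastTwo] (p : Polynomial ℤ) :
          (OfNat.ofNat n * p).coeff j = OfNat.ofNat n * p.coeff j := by
        rw [← map_ofNat Polynomial.C n, Polynomial.coeff_C_mul]
      simp only [Polynomial.coeff_add, hcoeff]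
      refine ⟨?_, fun h => ?_⟩
      -- Passing from index `i` to `i + m` costs at most `⌈m / 2⌉` powers of `5`, that is `0, 1, 1,
      -- 2, 2` for `m = 0, …, 4`: exactly the valuations of `1, 5, 15, 25, 25`.
      · have step {i' v c : ℕ} {p : Polynomial ℤ} (hp : FiveAdicBound i' p)
            (hv : i' ≤ 5 * j → (5 * (j + 1) - (i + 5) - 1) / 2 ≤ v + (5 * j - i' - 1) / 2)
            (hc : 5 ^ v ∣ c) :
            (5 : ℤ) ^ ((5 * (j + 1) - (i + 5) - 1) / 2) ∣ c * p.coeff j := by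
          by_cases h : 5 * j < i'
          · rw [(hp j).2 h, mul_zero]
            exact dvd_zero _
          · refine (pow_dvd_pow 5 (hv (not_lt.1 h))).trans ?_
            rw [pow_add]
            exact mul_dvd_mul (by exact_mod_cast hc) (hp j).1
        have s0 := step (v := 0) (c := 1) h0 (by omega) (by norm_num)
        rw [Nat.cast_one, one_mul] at s0
        exact (((s0.add (step (v := 1) (c := 5) h1 (by omega) (by norm_num))).add
          (step (v := 1) (c := 15) h2 (by omega) (by norm_num))).add
          (step (v := 2) (c := 25) h3 (by omega) (by norm_num))).add
          (step (v := 2) (c := 25) h4 (by omega) (by norm_num))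
      · rw [(h0 j).2 (by omega), (h1 j).2 (by omega), (h2 j).2 (by omega), (h3 j).2 (by omega),
          (h4 j).2 (by omega)]
        simp

/-- Multiplying by `tau ^ i` turns the section into that of `zeta ^ (6 i + k)`, since `τ(q⁵) τ =
ζ⁶`. The resulting polynomial starts at some `j` with `5 j ≥ 6 i + k`, so `X ^ i` can be cancelled.
-/
theorem exists_section5_zeta_pow_mul_tau_pow (k i : ℕ) : ∃ r : Polynomial ℤ,
    section5 0 (zeta ^ k * tau ^ i) = evalTau r ∧
    ∀ j, (5 : ℤ) ^ ((5 * j - i - k - 1) / 2) ∣ r.coeff j ∧ (5 * j < i + k → r.coeff j = 0) := by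
  have hb := fiveAdicBound_zetaPoly (6 * i + k)
  obtain ⟨r, hr⟩ : Polynomial.X ^ i ∣ zetaPoly (6 * i + k) :=
    Polynomial.X_pow_dvd_iff.2 fun d hd => (hb d).2 (by omega)
  have hcoeff (j : ℕ) : r.coeff j = (zetaPoly (6 * i + k)).coeff (j + i) := by
    rw [hr, Polynomial.coeff_X_pow_mul]
  refine ⟨r, ?_, fun j => ?_⟩
  · refine mul_left_cancel₀ (pow_ne_zero i tau_ne_zero) ?_
    rw [← section5_expandFive_mul (by norm_num), map_pow,
      show expandFive tau ^ i * (zeta ^ k * tau ^ i) = zeta ^ (6 * i + k) by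
        rw [pow_add, pow_mul, ← expandFive_tau_mul_tau]; ring,
      section5_zeta_pow, hr, map_mul, map_pow, evalTau_X]
  · rw [hcoeff]
    have h := hb (j + i)
    rw [show 5 * (j + i) - (6 * i + k) - 1 = 5 * j - i - k - 1 by omega] at h
    exact ⟨h.1, fun h1 => h.2 (by omega)⟩

/-- How the operator `f ↦ section5 0 (zeta ^ k * f)` acts on polynomials in `tau` with prescribed
`5`-adic valuations of the coefficients. -/
theorem exists_section5_zeta_pow_mul_aeval (k l : ℕ) (v w : ℕ → ℕ)
    (hvw : ∀ i j, l ≤ i → i + k ≤ 5 * j → w j ≤ v i + (5 * j - i - k - 1) / 2)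
    {p : Polynomial ℤ} (hp : ∀ i, (5 : ℤ) ^ v i ∣ p.coeff i ∧ (i < l → p.coeff i = 0)) :
    ∃ r : Polynomial ℤ,
      section5 0 (zeta ^ k * evalTau p) = evalTau r ∧
      ∀ j, (5 : ℤ) ^ w j ∣ r.coeff j ∧ (5 * j < l + k → r.coeff j = 0) := by
  choose r hr hr2 using exists_section5_zeta_pow_mul_tau_pow k
  refine ⟨∑ i ∈ p.support, Polynomial.C (p.coeff i) * r i, ?_, fun j => ?_⟩
  · conv_lhs => rw [p.as_sum_support]
    rw [map_sum, map_sum, mul_sum, map_sum]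
    refine sum_congr rfl fun i _ => ?_
    rw [← Polynomial.C_mul_X_pow_eq_monomial, map_mul evalTau, map_mul evalTau, map_pow evalTau,
      evalTau_X, evalTau_C, ← hr, mul_left_comm]
    ext n
    simp only [coeff_section5, coeff_C_mul]
  · rw [Polynomial.finsetSum_coeff]
    refine ⟨dvd_sum fun i hi => ?_, fun h => sum_eq_zero fun i hi => ?_⟩
    · rw [Polynomial.coeff_C_mul]
      by_cases h1 : i < l
      · rw [(hp i).2 h1, zero_mul]
        exact dvd_zero _
      · by_cases h2 : 5 * j < i + k
        · rw [(hr2 i j).2 h2, mul_zero]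
          exact dvd_zero _
        · refine (pow_dvd_pow 5 (hvw i j (not_lt.1 h1) (not_lt.1 h2))).trans ?_
          rw [pow_add]
          exact mul_dvd_mul (hp i).1 (hr2 i j).1
    · rw [Polynomial.coeff_C_mul]
      by_cases h1 : i < l
      · rw [(hp i).2 h1, zero_mul]
      · rw [(hr2 i j).2 (by omega), mul_zero]

end Valuation

/-! ### The generating function of colored partitions. -/

section Partitions

/-- The number of `k`-colored partitions of `n` all of whose colored parts lie in `s`. -/
noncomputable def restrictedCount {k : ℕ} (s : Finset (ℕ × Fin k)) (n : ℕ) : ℕ :=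
  {x : ColoredPartition k n | ∀ p ∈ x.parts, p ∈ s}.ncard

theorem restrictedCount_empty {k : ℕ} (n : ℕ) :
    restrictedCount (∅ : Finset (ℕ × Fin k)) n = if n = 0 then 1 else 0 := by
  have hx (x : ColoredPartition k n) : (∀ p ∈ x.parts, p ∈ (∅ : Finset (ℕ × Fin k))) ↔
      x.parts = 0 := by
    rw [Multiset.eq_zero_iff_forall_notMem]
    simp only [Finset.notMem_empty]
  rw [restrictedCount]
  simp only [hx]
  split_ifs with h
  · subst h
    rw [Set.ncard_eq_one]
    refine ⟨⟨0, by simp, by simp⟩, ?_⟩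
    ext x
    simp [ColoredPartition.ext_iff]
  · rw [Set.ncard_eq_zero]
    ext x
    simp only [Set.mem_ofPred_eq, Set.mem_empty_iff_false, iff_false]
    intro h0
    have := x.parts_sum
    rw [h0] at this
    exact h (by simpa using this.symm)

theorem restrictedCount_insert_of_lt {k : ℕ} [DecidableEq (ℕ × Fin k)] {s : Finset (ℕ × Fin k)}
    {a : ℕ × Fin k} {n : ℕ} (hn : n < a.1) :
    restrictedCount (insert a s) n = restrictedCount s n := by
  rw [restrictedCount, restrictedCount]
  congr 1
  ext x
  refine ⟨fun h p hp => (mem_insert.1 (h p hp)).resolve_left ?_,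
    fun h p hp => mem_insert_of_mem (h p hp)⟩
  rintro rfl
  have h1 := Multiset.single_le_sum (s := x.parts.map Prod.fst) (fun _ _ => Nat.zero_le _)
    p.1 (Multiset.mem_map_of_mem _ hp)
  rw [x.parts_sum] at h1
  omega

/-- Either `a` does not occur, or one copy of it can be removed. This is the coefficient form of
multiplying by `1 - q ^ a.1`. -/
theorem restrictedCount_insert_add {k : ℕ} [DecidableEq (ℕ × Fin k)] {s : Finset (ℕ × Fin k)}
    {a : ℕ × Fin k} (ha : a ∉ s) (ha0 : 0 < a.1) (n : ℕ) :
    restrictedCount (insert a s) (n + a.1) =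
      restrictedCount s (n + a.1) + restrictedCount (insert a s) n := by
  let f : ColoredPartition k n → ColoredPartition k (n + a.1) := fun x =>
    ⟨a ::ₘ x.parts, by
      intro p hp
      rcases Multiset.mem_cons.1 hp with rfl | hp
      · exact ha0
      · exact x.parts_pos p hp, by
      rw [Multiset.map_cons, Multiset.sum_cons, x.parts_sum, add_comm]⟩
  have hf : Function.Injective f := fun x y h => by
    ext1
    exact (Multiset.cons_inj_right a).1 (congrArg ColoredPartition.parts h)
  rw [restrictedCount, restrictedCount, restrictedCount,
    ← Set.ncard_image_of_injective {x : ColoredPartition k n | _} hf, ← Set.ncard_union_eq]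
  · congr 1
    ext x
    simp only [Set.mem_ofPred_eq, Set.mem_union, Set.mem_image]
    constructor
    · intro h
      by_cases hax : a ∈ x.parts
      · right
        obtain ⟨m, hm⟩ := Multiset.exists_cons_of_mem hax
        refine ⟨⟨m, fun p hp => x.parts_pos p ?_, ?_⟩, fun p hp => h p ?_, ?_⟩
        · rw [hm]
          exact Multiset.mem_cons_of_mem hp
        · have h1 := x.parts_sum
          rw [hm, Multiset.map_cons, Multiset.sum_cons] at h1
          omega
        · rw [hm]
          exact Multiset.mem_cons_of_mem hp
        · ext1
          exact hm.symm
      · left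
        refine fun p hp => (mem_insert.1 (h p hp)).resolve_left ?_
        rintro rfl
        exact hax hp
    · rintro (h | ⟨y, hy, rfl⟩) p hp
      · exact mem_insert_of_mem (h p hp)
      · rcases Multiset.mem_cons.1 hp with rfl | hp
        · exact mem_insert_self _ _
        · exact hy p hp
  · rw [Set.disjoint_left]
    rintro _ h ⟨y, _, rfl⟩
    exact ha (h a (Multiset.mem_cons_self a _))

theorem mk_restrictedCount_mul_prod {k : ℕ} (s : Finset (ℕ × Fin k)) (hs : ∀ p ∈ s, 0 < p.1) :
    (PowerSeries.mk fun n => (restrictedCount s n : ℤ)) * ∏ p ∈ s, (1 - X ^ p.1) = 1 := by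
  classical
  induction s using Finset.induction_on with
  | empty =>
    rw [prod_empty, mul_one]
    ext n
    rw [coeff_mk, restrictedCount_empty, coeff_one]
    split_ifs <;> simp
  | insert a s ha ih =>
    have ih' := ih fun p hp => hs p (mem_insert_of_mem hp)
    have ha0 := hs a (mem_insert_self _ _)
    rw [prod_insert ha, ← mul_assoc]
    convert ih' using 2
    ext n
    rw [mul_sub, mul_one, map_sub, coeff_mul_X_pow', coeff_mk, coeff_mk]
    split_ifs with hn
    · obtain ⟨m, rfl⟩ := Nat.exists_eq_add_of_le' hn
      rw [Nat.add_sub_cancel, coeff_mk, restrictedCount_insert_add ha ha0]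
      push_cast
      ring
    · rw [restrictedCount_insert_of_lt (not_le.1 hn), sub_zero, coeff_mk]

theorem restrictedCount_eq_coloredPartitionCount {k n N : ℕ} (h : n ≤ N) :
    restrictedCount ((range N).map ⟨Nat.succ, Nat.succ_injective⟩ ×ˢ (univ : Finset (Fin k))) n =
      coloredPartitionCount k n := by
  rw [restrictedCount, coloredPartitionCount, ← Set.ncard_univ]
  congr 1
  refine Set.eq_univ_of_forall fun x p hp => ?_
  have h0 := x.parts_pos p hp
  have h1 := Multiset.single_le_sum (s := x.parts.map Prod.fst) (fun _ _ => Nat.zero_le _)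
    p.1 (Multiset.mem_map_of_mem _ hp)
  rw [x.parts_sum] at h1
  rw [mem_product]
  refine ⟨mem_map.2 ⟨p.1 - 1, mem_range.2 (by omega), ?_⟩, mem_univ _⟩
  exact Nat.succ_pred_eq_of_pos h0

/-- The generating function of `k`-colored partitions. -/
theorem mk_coloredPartitionCount_mul_euler_pow (k : ℕ) :
    (PowerSeries.mk fun n => (coloredPartitionCount k n : ℤ)) * euler ^ k = 1 := by
  refine eq_of_forall_X_pow_dvd_sub fun N => ?_
  set s := (range N).map ⟨Nat.succ, Nat.succ_injective⟩ ×ˢ (univ : Finset (Fin k)) with hs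
  have h1 : X ^ N ∣ (PowerSeries.mk fun n => (coloredPartitionCount k n : ℤ)) -
      (PowerSeries.mk fun n => (restrictedCount s n : ℤ)) := by
    rw [X_pow_dvd_iff]
    intro m hm
    rw [map_sub, coeff_mk, coeff_mk, hs, restrictedCount_eq_coloredPartitionCount hm.le, sub_self]
  have h2 := (pow_dvd_pow X N.le_succ).trans (X_pow_dvd_pentagonalSeries_sub (R := ℤ) N)
  have h3 : ∏ p ∈ s, (1 - X ^ p.1 : ℤ⟦X⟧) = eulerProd ℤ N ^ k := by
    rw [hs, prod_product, prod_map, eulerProd, ← prod_pow]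
    refine prod_congr rfl fun m _ => ?_
    simp
  have h4 := mk_restrictedCount_mul_prod s (by
    intro p hp
    obtain ⟨m, _, hm⟩ := mem_map.1 (mem_product.1 hp).1
    rw [← hm]
    exact Nat.succ_pos m)
  rw [h3] at h4
  simp only [← Ideal.mem_span_singleton, ← Ideal.Quotient.eq] at h1 h2 ⊢
  rw [map_mul, map_pow, h1, h2, ← map_pow, ← map_mul, h4]

end Partitions

/-! ### Iteration along the progressions, and reduction modulo 5. -/

section Iteration

/-- The generating function of the numbers `p_{-6}(5 ^ α n + (3 * 5 ^ α + 1) / 4)`. -/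
noncomputable def progressionSeries (α : ℕ) : ℤ⟦X⟧ :=
  PowerSeries.mk fun n => (coloredPartitionCount 6 (5 ^ α * n + (3 * 5 ^ α + 1) / 4) : ℤ)

theorem section5_progressionSeries (α : ℕ) :
    section5 3 (progressionSeries α) = progressionSeries (α + 1) := by
  ext n
  rw [coeff_section5, progressionSeries, progressionSeries, coeff_mk, coeff_mk]
  have h1 := Nat.mul_div_cancel' (four_dvd_mul_five_pow_add_one 3 α (by norm_num))
  have h2 := Nat.mul_div_cancel' (four_dvd_mul_five_pow_add_one 3 (α + 1) (by norm_num))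
  have h3 : 5 ^ α * (5 * n + 3) = 5 ^ (α + 1) * n + 3 * 5 ^ α := by ring
  have h4 : 5 ^ (α + 1) = 5 * 5 ^ α := pow_succ' _ _
  rw [h3, show 5 ^ (α + 1) * n + 3 * 5 ^ α + (3 * 5 ^ α + 1) / 4 =
    5 ^ (α + 1) * n + (3 * 5 ^ (α + 1) + 1) / 4 by omega]

theorem section5_eulerInv_pow_six : section5 4 (eulerInv ^ 6) = progressionSeries 1 := by
  have h : eulerInv ^ 6 = PowerSeries.mk fun n => (coloredPartitionCount 6 n : ℤ) := by
    refine (isUnit_pentagonalSeries.pow 6).mul_right_cancel (b := euler ^ 6) ?_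
    rw [mk_coloredPartitionCount_mul_euler_pow, ← mul_pow, mul_comm, euler_mul_eulerInv, one_pow]
  rw [h]
  ext n
  rw [coeff_section5, coeff_mk, progressionSeries, coeff_mk, pow_one]

theorem zeta_pow_six_mul (f : ℤ⟦X⟧) :
    section5 0 (zeta ^ 6 * f) = expandFive euler ^ 6 * section5 0 (X ^ 6 * (eulerInv ^ 6 * f)) := by
  have h : zeta ^ 6 * f = expandFive (expandFive euler ^ 6) * (X ^ 6 * (eulerInv ^ 6 * f)) := by
    rw [map_pow, zeta]
    ring
  rw [h, section5_expandFive_mul (by norm_num)]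

theorem exists_progressionSeries_one : ∃ p : Polynomial ℤ,
    expandFive euler ^ 6 * X ^ 2 * progressionSeries 1 = evalTau p ∧
    ∀ j, (5 : ℤ) ^ (1 + (5 * j - 10) / 2) ∣ p.coeff j ∧ (j < 2 → p.coeff j = 0) := by
  have h1 : expandFive euler ^ 6 * X ^ 2 * progressionSeries 1 = section5 0 (zeta ^ 6) := by
    rw [← mul_one (zeta ^ 6), zeta_pow_six_mul, mul_one,
      section5_X_pow_mul (a := 2) (s := 4) (by norm_num) (by norm_num), section5_eulerInv_pow_six,
      mul_assoc]
  have h2 := fiveAdicBound_zetaPoly 6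
  have h3 := section5_zeta_pow 6
  generalize zetaPoly 6 = p at h2 h3
  refine ⟨p, h1.trans h3, fun j => ⟨?_, fun hj => (h2 j).2 (by omega)⟩⟩
  by_cases hj : j < 2
  · rw [(h2 j).2 (by omega)]
    exact dvd_zero _
  · exact (pow_dvd_pow 5 (by omega)).trans (h2 j).1

theorem exists_progressionSeries_of_odd {α : ℕ} (h : ∃ p : Polynomial ℤ,
    expandFive euler ^ 6 * X ^ 2 * progressionSeries α = evalTau p ∧
    ∀ j, (5 : ℤ) ^ (α + (5 * j - 10) / 2) ∣ p.coeff j ∧ (j < 2 → p.coeff j = 0)) :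
    ∃ p : Polynomial ℤ, euler ^ 6 * X * progressionSeries (α + 1) = evalTau p ∧
    ∀ j, (5 : ℤ) ^ (α + 1 + (5 * j - 5) / 2) ∣ p.coeff j ∧ (j < 1 → p.coeff j = 0) := by
  obtain ⟨p, hp, hp2⟩ := h
  obtain ⟨r, hr, hr2⟩ := exists_section5_zeta_pow_mul_aeval 0 2 (fun j => α + (5 * j - 10) / 2)
    (fun j => α + 1 + (5 * j - 5) / 2) (fun i j hi hj => by
      -- Equality holds at the lowest index `i = 2`, where the gain is exactly one factor `5`.
      rcases hi.eq_or_lt with rfl | hi <;> omega) hp2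
  refine ⟨r, ?_, fun j => ⟨(hr2 j).1, fun hj => (hr2 j).2 (by omega)⟩⟩
  have hF : expandFive euler ^ 6 * X ^ 2 * progressionSeries α =
      expandFive (euler ^ 6) * (X ^ 2 * progressionSeries α) := by rw [map_pow, mul_assoc]
  rw [← hr, ← hp, pow_zero, one_mul, hF, section5_expandFive_mul (by norm_num),
    section5_X_pow_mul (a := 1) (s := 3) (by norm_num) (by norm_num), section5_progressionSeries,
    pow_one, mul_assoc]

theorem exists_progressionSeries_of_even {α : ℕ} (h : ∃ p : Polynomial ℤ,
    euler ^ 6 * X * progressionSeries α = evalTau p ∧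
    ∀ j, (5 : ℤ) ^ (α + (5 * j - 5) / 2) ∣ p.coeff j ∧ (j < 1 → p.coeff j = 0)) :
    ∃ p : Polynomial ℤ,
      expandFive euler ^ 6 * X ^ 2 * progressionSeries (α + 1) = evalTau p ∧
    ∀ j, (5 : ℤ) ^ (α + 1 + (5 * j - 10) / 2) ∣ p.coeff j ∧ (j < 2 → p.coeff j = 0) := by
  obtain ⟨p, hp, hp2⟩ := h
  obtain ⟨r, hr, hr2⟩ := exists_section5_zeta_pow_mul_aeval 6 1 (fun j => α + (5 * j - 5) / 2)
    (fun j => α + 1 + (5 * j - 10) / 2) (fun i j hi hj => by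
      -- Again there is equality at the lowest index, now `i = 1`.
      rcases hi.eq_or_lt with rfl | hi <;> omega) hp2
  refine ⟨r, ?_, fun j => ⟨(hr2 j).1, fun hj => (hr2 j).2 (by omega)⟩⟩
  have h6 : euler ^ 6 * eulerInv ^ 6 = 1 := by rw [← mul_pow, euler_mul_eulerInv, one_pow]
  rw [← hr, ← hp, zeta_pow_six_mul, show X ^ 6 * (eulerInv ^ 6 * (euler ^ 6 * X *
    progressionSeries α)) = X ^ 7 * progressionSeries α by
      linear_combination X ^ 7 * progressionSeries α * h6,
    section5_X_pow_mul (a := 2) (s := 3) (by norm_num) (by norm_num), section5_progressionSeries,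
    mul_assoc]

theorem exists_progressionSeries_odd (β : ℕ) : ∃ p : Polynomial ℤ,
    expandFive euler ^ 6 * X ^ 2 * progressionSeries (2 * β + 1) = evalTau p ∧
    ∀ j, (5 : ℤ) ^ (2 * β + 1 + (5 * j - 10) / 2) ∣ p.coeff j ∧ (j < 2 → p.coeff j = 0) := by
  induction β with
  | zero => exact exists_progressionSeries_one
  | succ β ih => exact exists_progressionSeries_of_even (exists_progressionSeries_of_odd ih)

theorem evalTau_eq_of_dvd {p : Polynomial ℤ} {l : ℕ} {d : ℤ} (h0 : ∀ j < l, p.coeff j = 0)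
    (hd : ∀ j, l < j → d ∣ p.coeff j) :
    ∃ W : ℤ⟦X⟧, evalTau p = C (p.coeff l) * tau ^ l + C d * tau ^ (l + 1) * W := by
  obtain ⟨r, rfl⟩ := Polynomial.X_pow_dvd_iff.2 h0
  obtain ⟨s, hs⟩ : Polynomial.C d ∣ r.divX := by
    rw [Polynomial.C_dvd_iff_dvd_coeff]
    intro j
    have h := hd (j + 1 + l) (by omega)
    rwa [Polynomial.coeff_X_pow_mul, ← Polynomial.coeff_divX] at h
  refine ⟨evalTau s, ?_⟩
  have hr := Polynomial.divX_mul_X_add r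
  have hc : (Polynomial.X ^ l * r).coeff l = r.coeff 0 := by
    simpa using Polynomial.coeff_X_pow_mul r l 0
  rw [hc, map_mul, map_pow, evalTau_X]
  conv_lhs => rw [← hr, hs]
  rw [map_add, map_mul, map_mul, evalTau_X, evalTau_C, evalTau_C]
  ring

/-- The leading term is `c τ` for even `α` and `c τ²` for odd `α`; after division by the respective
prefactors `E⁶ q` and `E(q⁵)⁶ q²`, both become `c E(q⁵)⁶ / E¹²`. All higher terms carry at least two
further factors `5`. -/
theorem exists_progressionSeries_eq {α : ℕ} (hα : 1 ≤ α) : ∃ (c : ℤ) (w : ℤ⟦X⟧),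
    (5 : ℤ) ^ α ∣ c ∧ progressionSeries α =
      C c * (expandFive euler ^ 6 * eulerInv ^ 12) + C (5 ^ (α + 1)) * w := by
  have hE6 : IsUnit (euler ^ 6) := isUnit_pentagonalSeries.pow 6
  have hF6 : IsUnit (expandFive euler ^ 6) := (isUnit_pentagonalSeries.map expandFive).pow 6
  rcases Nat.even_or_odd' α with ⟨β, rfl | rfl⟩
  · obtain ⟨γ, rfl⟩ := Nat.exists_eq_add_of_le' (show 1 ≤ β by omega)
    obtain ⟨p, hp, hp2⟩ := exists_progressionSeries_of_odd (exists_progressionSeries_odd γ)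
    obtain ⟨W, hW⟩ := evalTau_eq_of_dvd (p := p) (l := 1) (d := 5 ^ (2 * (γ + 1) + 1))
      (fun j hj => (hp2 j).2 hj)
      fun j hj => (pow_dvd_pow 5 (by omega)).trans (hp2 j).1
    refine ⟨p.coeff 1, X * expandFive euler ^ 12 * eulerInv ^ 18 * W,
      (pow_dvd_pow 5 (by omega)).trans (hp2 1).1, ?_⟩
    have h6 : euler ^ 6 * eulerInv ^ 6 = 1 := by rw [← mul_pow, euler_mul_eulerInv, one_pow]
    refine hE6.mul_left_cancel (X_mul_cancel ?_)
    rw [hW, tau] at hp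
    rw [show 2 * (γ + 1) = 2 * γ + 1 + 1 by ring] at hp ⊢
    linear_combination hp - (C (p.coeff 1) * X * expandFive euler ^ 6 * eulerInv ^ 6 +
      C (5 ^ (2 * γ + 1 + 1 + 1)) * X ^ 2 * expandFive euler ^ 12 * eulerInv ^ 12 * W) * h6
  · obtain ⟨p, hp, hp2⟩ := exists_progressionSeries_odd β
    obtain ⟨W, hW⟩ := evalTau_eq_of_dvd (p := p) (l := 2) (d := 5 ^ (2 * β + 1 + 1))
      (fun j hj => (hp2 j).2 hj)
      fun j hj => (pow_dvd_pow 5 (by omega)).trans (hp2 j).1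
    refine ⟨p.coeff 2, X * expandFive euler ^ 12 * eulerInv ^ 18 * W,
      (pow_dvd_pow 5 (by omega)).trans (hp2 2).1, ?_⟩
    refine hF6.mul_left_cancel (X_pow_mul_cancel (k := 2) ?_)
    rw [hW, tau] at hp
    linear_combination hp

theorem C_five_dvd_expandFive_euler_sub : C (5 : ℤ) ∣ expandFive euler - euler ^ 5 := by
  have hp : Fact (Nat.Prime 5) := ⟨by norm_num⟩
  have h : map (Int.castRingHom (ZMod 5)) (expandFive euler - euler ^ 5) = 0 := by
    rw [map_sub, map_pow, map_expand, map_pentagonalSeries, sub_eq_zero]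
    have h1 := MvPowerSeries.map_frobenius_expand (p := 5) (by norm_num)
      (f := pentagonalSeries (ZMod 5))
    rw [ZMod.frobenius_zmod, MvPowerSeries.map_id] at h1
    exact h1
  refine ⟨PowerSeries.mk fun n => coeff n (expandFive euler - euler ^ 5) / 5, ?_⟩
  ext n
  rw [coeff_C_mul, coeff_mk]
  have h2 := congrArg (coeff n) h
  rw [coeff_map, map_zero, eq_intCast, ZMod.intCast_zmod_eq_zero_iff_dvd] at h2
  exact (Int.mul_ediv_cancel' h2).symm

/-- By Frobenius `E(q⁵)³ ≡ E¹⁵` modulo `5`, so the quotient is congruent to `E(q⁵)³ E³`, and the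
first factor passes through `section5 r`. -/
theorem five_dvd_coeff_expandFive_pow_mul {r : ℕ} (hr : r = 2 ∨ r = 4) (n : ℕ) :
    (5 : ℤ) ∣ coeff (5 * n + r) (expandFive euler ^ 6 * eulerInv ^ 12) := by
  obtain ⟨v, hv⟩ := C_five_dvd_expandFive_euler_sub
  have h12 : euler ^ 12 * eulerInv ^ 12 = 1 := by rw [← mul_pow, euler_mul_eulerInv, one_pow]
  have h : expandFive euler ^ 6 * eulerInv ^ 12 = expandFive (euler ^ 3) * euler ^ 3 +
      C 5 * (expandFive euler ^ 3 * eulerInv ^ 12 * v *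
        (expandFive euler ^ 2 + expandFive euler * euler ^ 5 + euler ^ 10)) := by
    rw [map_pow]
    linear_combination expandFive euler ^ 3 * euler ^ 3 * h12 + expandFive euler ^ 3 *
      eulerInv ^ 12 * (expandFive euler ^ 2 + expandFive euler * euler ^ 5 + euler ^ 10) * hv
  rw [h, ← coeff_section5, map_add, section5_expandFive_mul (by omega),
    section5_pentagonalSeries_pow_three hr, mul_zero, zero_add, coeff_section5, coeff_C_mul]
  exact dvd_mul_right _ _

end Iteration

end SixColored

open SixColored PowerSeries in
theorem theorem1p3 (n α : ℕ) (hα : 1 ≤ α) :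
    coloredPartitionCount 6 (5 ^ α * n + (3 * 5 ^ α + 1) / 4) ≡ 0 [MOD 5 ^ α] ∧
    coloredPartitionCount 6 (5 ^ (α + 1) * n + (11 * 5 ^ α + 1) / 4) ≡ 0 [MOD 5 ^ (α + 1)] ∧
    coloredPartitionCount 6 (5 ^ (α + 1) * n + (19 * 5 ^ α + 1) / 4) ≡ 0 [MOD 5 ^ (α + 1)] := by
  obtain ⟨c, w, hc, hg⟩ := exists_progressionSeries_eq hα
  have hcoeff (m : ℕ) :
      (coloredPartitionCount 6 (5 ^ α * m + (3 * 5 ^ α + 1) / 4) : ℤ) =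
        c * coeff m (expandFive euler ^ 6 * eulerInv ^ 12) + 5 ^ (α + 1) * coeff m w := by
    have h := congrArg (coeff m) hg
    rwa [progressionSeries, coeff_mk, map_add, coeff_C_mul, coeff_C_mul] at h
  have hres {r : ℕ} (hr : r = 2 ∨ r = 4) :
      5 ^ (α + 1) ∣ coloredPartitionCount 6 (5 ^ α * (5 * n + r) + (3 * 5 ^ α + 1) / 4) := by
    have h : (5 : ℤ) ^ (α + 1) ∣
        (coloredPartitionCount 6 (5 ^ α * (5 * n + r) + (3 * 5 ^ α + 1) / 4) : ℤ) := by
      rw [hcoeff]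
      refine dvd_add ?_ (dvd_mul_right _ _)
      rw [pow_succ]
      exact mul_dvd_mul hc (five_dvd_coeff_expandFive_pow_mul hr n)
    exact_mod_cast h
  have h3 := Nat.mul_div_cancel' (four_dvd_mul_five_pow_add_one 3 α (by norm_num))
  have h11 := Nat.mul_div_cancel' (four_dvd_mul_five_pow_add_one 11 α (by norm_num))
  have h19 := Nat.mul_div_cancel' (four_dvd_mul_five_pow_add_one 19 α (by norm_num))
  refine ⟨Nat.modEq_zero_iff_dvd.2 ?_, Nat.modEq_zero_iff_dvd.2 ?_, Nat.modEq_zero_iff_dvd.2 ?_⟩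
  · have h : (5 : ℤ) ^ α ∣ (coloredPartitionCount 6 (5 ^ α * n + (3 * 5 ^ α + 1) / 4) : ℤ) := by
      rw [hcoeff]
      exact dvd_add (hc.mul_right _) ((pow_dvd_pow 5 α.le_succ).mul_right _)
    exact_mod_cast h
  -- `11 = 3 + 4 · 2`, and likewise `19 = 3 + 4 · 4` below, so these are the subprogressions `5 n +
  -- 2` and `5 n + 4` of the first one.
  · convert hres (Or.inl rfl) using 2
    rw [show 5 ^ α * (5 * n + 2) = 5 ^ (α + 1) * n + 2 * 5 ^ α by ring]
    omega
  · convert hres (Or.inr rfl) using 2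
    rw [show 5 ^ α * (5 * n + 4) = 5 ^ (α + 1) * n + 4 * 5 ^ α by ring]
    omega
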